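/- Let $M$ be a 4-dimensional smooth (Hausdorff) manifold without boundary, equipped with a smooth metric tensor field $g$ of Lorentzian signature $(-,+,+,+)$ and a time orientation. A tangent vector $v$ is timelike if $g(v,v)<0$, and lightlike if $v\neq 0$ and $g(v,v)=0$. Let $\gamma : I \to M$ be a clock, i.e. a smooth embedding of a non-degenerate real interval $I$ into $M$ whose tangent vector $\dot\gamma(t)$ is timelike and future-pointing for every $t\in I$. Let $t_0$ be an interior point of $I$ and $p=\gamma(t_0)$. Then there are open subsets $U$ and $V$ of $M$ with $p\in U\subset V$ such that every point $q\in U\setminus\gamma(I)$ can be connected to $\gamma(I)$ by precisely one future-pointing and by precisely one past-pointing light ray that stays within $V$. (In this case $U$ is called a radar neighborhood of $p$ with respect to $\gamma$.) Here a future-pointing (past-pointing) light ray connecting $q$ to $\gamma(I)$ within $V$ is a geodesic segment $c:[0,1]\to V$ of $g$, affinely parametrized, with $c(0)=q$, $c(1)\in\gamma(I)$ and $\dot c(s)$ lightlike and future-pointing (past-pointing) for all $s\in[0,1]$. (Fixing the parameter interval $[0,1]$ removes the freedom of affine reparametrization.) -/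

import Mathlib

open scoped Manifold ContDiff Topology
open Bundle

/-- A smooth Lorentzian metric of signature `(-,+,+,+)` on a 4-dimensional manifold. -/
structure LorentzMetric (M : Type*) [TopologicalSpace M]
    [ChartedSpace (EuclideanSpace ℝ (Fin 4)) M] [IsManifold (𝓡 4) ∞ M] where
  /-- the bilinear form on each tangent space -/
  val : ∀ x : M, TangentSpace (𝓡 4) x →L[ℝ] TangentSpace (𝓡 4) x →L[ℝ] ℝ
  symm : ∀ (x : M) (v w : TangentSpace (𝓡 4) x), val x v w = val x w v
  /-- every tangent space has a basis in which the form is `diag(-1, 1, 1, 1)` -/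
  lorentzian : ∀ x : M, ∃ b : Module.Basis (Fin 4) ℝ (TangentSpace (𝓡 4) x), ∀ i j : Fin 4,
    val x (b i) (b j) = if i = j then (if i = 0 then -1 else 1) else 0
  /-- the form is a smooth section of the bundle of bilinear forms on the tangent bundle -/
  smooth : ContMDiff (𝓡 4)
    ((𝓡 4).prod 𝓘(ℝ, EuclideanSpace ℝ (Fin 4) →L[ℝ] EuclideanSpace ℝ (Fin 4) →L[ℝ] ℝ)) ∞
    (fun x : M ↦ TotalSpace.mk'
      (EuclideanSpace ℝ (Fin 4) →L[ℝ] EuclideanSpace ℝ (Fin 4) →L[ℝ] ℝ)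
      (E := fun x : M ↦ TangentSpace (𝓡 4) x →L[ℝ] TangentSpace (𝓡 4) x →L[ℝ] ℝ) x (val x))

section

variable {M : Type*} [TopologicalSpace M] [ChartedSpace (EuclideanSpace ℝ (Fin 4)) M]
  [IsManifold (𝓡 4) ∞ M]

/-- A tangent vector `v` is timelike if `g(v,v) < 0`. -/
def LorentzMetric.Timelike (g : LorentzMetric M) {x : M} (v : TangentSpace (𝓡 4) x) : Prop :=
  g.val x v v < 0

/-- A tangent vector `v` is lightlike if `v ≠ 0` and `g(v,v) = 0`. -/
def LorentzMetric.Lightlike (g : LorentzMetric M) {x : M} (v : TangentSpace (𝓡 4) x) : Prop :=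
  v ≠ 0 ∧ g.val x v v = 0

/-- A time orientation: a choice, in each tangent space, of one of the two cones of timelike
vectors as the future cone, which is consistent in the sense that near each point there is a
continuous vector field with values in the chosen cones. -/
structure TimeOrientation (g : LorentzMetric M) where
  /-- the set of future-pointing timelike vectors at each point -/
  futureCone : ∀ x : M, Set (TangentSpace (𝓡 4) x)
  isTimecone : ∀ x : M, ∃ u : TangentSpace (𝓡 4) x, g.Timelike u ∧
    futureCone x = {v | g.Timelike v ∧ g.val x u v < 0}
  consistent : ∀ x : M, ∃ W ∈ 𝓝 x, ∃ X : ∀ y : M, TangentSpace (𝓡 4) y,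
    ContinuousOn (fun y : M ↦ (⟨y, X y⟩ : TangentBundle (𝓡 4) M)) W ∧ ∀ y ∈ W, X y ∈ futureCone y

/-- A nonzero causal (timelike or lightlike) vector is future-pointing if it has negative scalar
product with the vectors of the future cone, i.e. if it lies in the closure of that cone. -/
def TimeOrientation.FuturePointing {g : LorentzMetric M} (τ : TimeOrientation g) {x : M}
    (v : TangentSpace (𝓡 4) x) : Prop :=
  v ≠ 0 ∧ g.val x v v ≤ 0 ∧ ∀ u ∈ τ.futureCone x, g.val x u v < 0

/-- A vector `v` is past-pointing if `-v` is future-pointing. -/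
def TimeOrientation.PastPointing {g : LorentzMetric M} (τ : TimeOrientation g) {x : M}
    (v : TangentSpace (𝓡 4) x) : Prop :=
  τ.FuturePointing (-v)

/-- The velocity at parameter value `s` of a curve `c` defined on the interval `J`. -/
noncomputable def velocity (c : ℝ → M) (J : Set ℝ) (s : ℝ) : TangentSpace (𝓡 4) (c s) :=
  mfderivWithin 𝓘(ℝ, ℝ) (𝓡 4) c J s (1 : ℝ)

/-- A clock with parameter interval `I`: a smooth embedding of `I` into `M` whose velocity is
everywhere timelike and future-pointing. (Such a curve is an immersion because a timelike vector is
nonzero.) The values of `γ` outside `I` are irrelevant. -/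
structure IsClock {g : LorentzMetric M} (τ : TimeOrientation g) (I : Set ℝ) (γ : ℝ → M) :
    Prop where
  interval : I.OrdConnected
  nondegenerate : I.Nontrivial
  smooth : ContMDiffOn 𝓘(ℝ, ℝ) (𝓡 4) ∞ γ I
  embedding : Topology.IsEmbedding (fun t : I ↦ γ t)
  timelike : ∀ t ∈ I, g.Timelike (velocity γ I t)
  futurePointing : ∀ t ∈ I, τ.FuturePointing (velocity γ I t)

/-- The metric in the chart around `x₀`: the value on `v, w` of the metric coefficients at the
coordinate point `y`. -/
noncomputable def LorentzMetric.inChart (g : LorentzMetric M) (x₀ : M)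
    (y v w : EuclideanSpace ℝ (Fin 4)) : ℝ :=
  g.val ((extChartAt (𝓡 4) x₀).symm y)
    (mfderiv 𝓘(ℝ, EuclideanSpace ℝ (Fin 4)) (𝓡 4) (extChartAt (𝓡 4) x₀).symm y v)
    (mfderiv 𝓘(ℝ, EuclideanSpace ℝ (Fin 4)) (𝓡 4) (extChartAt (𝓡 4) x₀).symm y w)

/-- The Christoffel symbols of the first kind in the chart around `x₀`, contracted with constant
vectors: `Γ(a, b; w) = ½ (∂ₐ g(b,w) + ∂_b g(a,w) - ∂_w g(a,b))`. -/
noncomputable def LorentzMetric.christoffel (g : LorentzMetric M) (x₀ : M)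
    (y a b w : EuclideanSpace ℝ (Fin 4)) : ℝ :=
  (fderiv ℝ (fun z ↦ g.inChart x₀ z b w) y a + fderiv ℝ (fun z ↦ g.inChart x₀ z a w) y b
    - fderiv ℝ (fun z ↦ g.inChart x₀ z a b) y w) / 2

/-- `c` is an (affinely parametrized) geodesic on the interval `J`: in the chart around any point,
`u = φ ∘ c` satisfies the geodesic equation `g_{lk} u''^k + Γ_{l,ij} u'^i u'^j = 0`. Solutions of
class `C²` are automatically smooth. -/
def LorentzMetric.IsGeodesicOn (g : LorentzMetric M) (c : ℝ → M) (J : Set ℝ) : Prop :=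
  ContMDiffOn 𝓘(ℝ, ℝ) (𝓡 4) 2 c J ∧
  ∀ x₀ : M, ∀ s ∈ J, c s ∈ (extChartAt (𝓡 4) x₀).source →
    let u : ℝ → EuclideanSpace ℝ (Fin 4) := fun r ↦ extChartAt (𝓡 4) x₀ (c r)
    let u' : ℝ → EuclideanSpace ℝ (Fin 4) := derivWithin u J
    let u'' : ℝ → EuclideanSpace ℝ (Fin 4) := derivWithin u' J
    ∀ w : EuclideanSpace ℝ (Fin 4),
      g.inChart x₀ (u s) (u'' s) w + g.christoffel x₀ (u s) (u' s) (u' s) w = 0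

/-- `c`, restricted to `[0,1]`, is a lightlike geodesic segment from the point `q` to a point of
the set `S` that stays within `V`. Every geodesic segment has exactly one orientation-preserving
affine parametrization by `[0,1]`. -/
structure LorentzMetric.IsLightRayWithin (g : LorentzMetric M) (V : Set M) (q : M) (S : Set M)
    (c : ℝ → M) : Prop where
  geodesic : g.IsGeodesicOn c (Set.Icc 0 1)
  lightlike : ∀ s ∈ Set.Icc (0 : ℝ) 1, g.Lightlike (velocity c (Set.Icc 0 1) s)
  start : c 0 = q
  finish : c 1 ∈ S
  stays : ∀ s ∈ Set.Icc (0 : ℝ) 1, c s ∈ V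

/-- `c` is a future-pointing light ray from `q` to `S` within `V`. -/
def TimeOrientation.IsFutureLightRay {g : LorentzMetric M} (τ : TimeOrientation g) (V : Set M)
    (q : M) (S : Set M) (c : ℝ → M) : Prop :=
  g.IsLightRayWithin V q S c ∧
    ∀ s ∈ Set.Icc (0 : ℝ) 1, τ.FuturePointing (velocity c (Set.Icc 0 1) s)

/-- `c` is a past-pointing light ray from `q` to `S` within `V`. -/
def TimeOrientation.IsPastLightRay {g : LorentzMetric M} (τ : TimeOrientation g) (V : Set M)
    (q : M) (S : Set M) (c : ℝ → M) : Prop :=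
  g.IsLightRayWithin V q S c ∧
    ∀ s ∈ Set.Icc (0 : ℝ) 1, τ.PastPointing (velocity c (Set.Icc 0 1) s)

end

/-! Everything happens in the chart around p = γ(t₀). There geodesics solve u'' = A(u)(u', u') with
A of class C¹. The right-hand side is quadratic in the velocity, hence Lipschitz with an arbitrarily
small constant near velocity zero. So two slow geodesics u₁, u₂ from one point q satisfy u₁(s) -
u₂(s) ≈ s(u₁'(0) - u₂'(0)) with small relative error (`IsSpraySolution.norm_sub_sub_le`). This
single estimate replaces normal neighborhoods and the differentiability of the exponential map.

Existence (`eventually_exists_nullRay`): by the estimate, exp_q is close to the identity, so β(t) =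
exp_q(v(t)) with v continuous, where β is the clock in coordinates. For q close to p, v(t) is
timelike in the cone of T = β'(t₀) at a parameter after t₀ and lies on the opposite side at one
before t₀. In between, v(t) crosses the boundary of the cone. It is nonzero there because q is off
the curve, so it is lightlike. Constancy of g(u', u') keeps the geodesic lightlike.

Uniqueness (`exists_ball_nullRay_unique`): if two null rays from q hit β at t < t', their initial
velocities differ by nearly β(t') - β(t), a timelike vector in the cone of T. A null vector plus a
timelike vector of the same cone is timelike, a contradiction. If t = t', the estimate forces equal
initial velocities. A competing ray is not assumed slow; `IsSpraySolution.velocity_le` shows that it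
is, since a causal velocity is controlled by a linear function whose total variation in a small ball
is small.

The chart sections identify light rays with coordinate null rays (`exists_unique_lightRay`). Past
rays are the same statement for t ↦ γ(-t) and -T. -/

/-! ### Quadratic second order equations: difference estimate and existence of solutions. -/

section Spray

set_option maxSynthPendingDepth 3

variable {E : Type*} [NormedAddCommGroup E] [NormedSpace ℝ E]

/-- `u`, with velocity `w`, solves the second order equation `u'' = A(u)(u', u')` on `[0,1]`. -/
structure IsSpraySolution (A : E → E →L[ℝ] E →L[ℝ] E) (u w : ℝ → E) : Prop where
  pos : ∀ s ∈ Set.Icc (0 : ℝ) 1, HasDerivWithinAt u (w s) (Set.Icc 0 1) s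
  vel : ∀ s ∈ Set.Icc (0 : ℝ) 1, HasDerivWithinAt w (A (u s) (w s) (w s)) (Set.Icc 0 1) s

/-- Comparing a solution with the resting one turns the difference estimate into a bound on its
deviation from straight motion. -/
theorem isSpraySolution_const (A : E → E →L[ℝ] E →L[ℝ] E) (q : E) :
    IsSpraySolution A (fun _ ↦ q) (fun _ ↦ 0) where
  pos s _ := hasDerivWithinAt_const s _ q
  vel s _ := by simpa using hasDerivWithinAt_const s (Set.Icc (0 : ℝ) 1) (0 : E)

/-- On a small ball with small velocities a spray is Lipschitz with a small constant. -/
theorem exists_spray_lipschitz {A : E → E →L[ℝ] E →L[ℝ] E} {x₀ : E} (hA : ContDiffAt ℝ 1 A x₀)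
    {κ : ℝ} (hκ : 0 < κ) :
    ∃ ρ > 0, ∀ y₁ ∈ Metric.ball x₀ ρ, ∀ y₂ ∈ Metric.ball x₀ ρ, ∀ w₁ ∈ Metric.ball (0 : E) ρ,
      ∀ w₂ ∈ Metric.ball (0 : E) ρ,
        ‖A y₁ w₁ w₁ - A y₂ w₂ w₂‖ ≤ κ * max ‖y₁ - y₂‖ ‖w₁ - w₂‖ := by
  let F : E × E → E := fun z ↦ A z.1 z.2 z.2
  have hA' : ContDiffAt ℝ 1 (fun z : E × E ↦ A z.1) (x₀, 0) :=
    ContDiffAt.comp (g := A) (x₀, (0 : E)) hA contDiffAt_fst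
  have hF : ContDiffAt ℝ 1 F (x₀, 0) := (hA'.clm_apply contDiffAt_snd).clm_apply contDiffAt_snd
  -- `F` is quadratic in the velocity, so its derivative vanishes at velocity 0; strict
  -- differentiability then gives any Lipschitz constant `κ` nearby.
  have hd : HasFDerivAt F (0 : E × E →L[ℝ] E) (x₀, 0) := by
    have h1 := (hA'.differentiableAt one_ne_zero).hasFDerivAt
    have h2 : HasFDerivAt (fun z : E × E ↦ z.2) (ContinuousLinearMap.snd ℝ E E) (x₀, (0 : E)) :=
      hasFDerivAt_snd
    have h3 := (h1.clm_apply h2).clm_apply h2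
    refine h3.congr_fderiv (ContinuousLinearMap.ext fun z ↦ ?_)
    have h4 : ∀ P : E × E →L[ℝ] E →L[ℝ] E, P.flip 0 = 0 := fun P ↦
      ContinuousLinearMap.ext fun x ↦ (P x).map_zero
    rw [h4]
    simp
  have hs : HasStrictFDerivAt F (0 : E × E →L[ℝ] E) (x₀, 0) :=
    hF.hasStrictFDerivAt' hd one_ne_zero
  have := hs.isLittleO.def hκ
  rw [Metric.eventually_nhds_iff] at this
  obtain ⟨ρ, hρ, h⟩ := this
  refine ⟨ρ, hρ, fun y₁ hy₁ y₂ hy₂ w₁ hw₁ w₂ hw₂ ↦ ?_⟩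
  have := @h ((y₁, w₁), (y₂, w₂)) (by
    simp only [Prod.dist_eq, sup_lt_iff]
    exact ⟨⟨hy₁, hw₁⟩, ⟨hy₂, hw₂⟩⟩)
  simpa [F, Prod.norm_def] using this

/-- Two solutions starting at the same point differ by nearly the linear solution. -/
theorem IsSpraySolution.norm_sub_sub_le {A : E → E →L[ℝ] E →L[ℝ] E} {x₀ : E} {κ ρ : ℝ}
    (hκ : κ ≤ 1 / 2)
    (hA : ∀ y₁ ∈ Metric.ball x₀ ρ, ∀ y₂ ∈ Metric.ball x₀ ρ, ∀ w₁ ∈ Metric.ball (0 : E) ρ,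
      ∀ w₂ ∈ Metric.ball (0 : E) ρ,
        ‖A y₁ w₁ w₁ - A y₂ w₂ w₂‖ ≤ κ * max ‖y₁ - y₂‖ ‖w₁ - w₂‖)
    (hκ0 : 0 < κ) {u₁ w₁ u₂ w₂ : ℝ → E} (h₁ : IsSpraySolution A u₁ w₁)
    (h₂ : IsSpraySolution A u₂ w₂)
    (hu₁ : ∀ s ∈ Set.Icc (0 : ℝ) 1, u₁ s ∈ Metric.ball x₀ ρ)
    (hw₁ : ∀ s ∈ Set.Icc (0 : ℝ) 1, w₁ s ∈ Metric.ball 0 ρ)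
    (hu₂ : ∀ s ∈ Set.Icc (0 : ℝ) 1, u₂ s ∈ Metric.ball x₀ ρ)
    (hw₂ : ∀ s ∈ Set.Icc (0 : ℝ) 1, w₂ s ∈ Metric.ball 0 ρ)
    (h0 : u₁ 0 = u₂ 0) :
    ∀ s ∈ Set.Icc (0 : ℝ) 1,
      ‖w₁ s - w₂ s - (w₁ 0 - w₂ 0)‖ ≤ 2 * κ * ‖w₁ 0 - w₂ 0‖ ∧
      ‖u₁ s - u₂ s - s • (w₁ 0 - w₂ 0)‖ ≤ 2 * κ * ‖w₁ 0 - w₂ 0‖ := by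
  have hmem0 : (0 : ℝ) ∈ Set.Icc (0 : ℝ) 1 := by simp
  have hwc : ContinuousOn (fun s ↦ ‖w₁ s - w₂ s‖) (Set.Icc 0 1) := fun s hs ↦
    ((h₁.vel s hs).continuousWithinAt.sub (h₂.vel s hs).continuousWithinAt).norm
  obtain ⟨m, hm, hmax⟩ := isCompact_Icc.exists_isMaxOn ⟨0, hmem0⟩ hwc
  -- The maximal velocity difference `D` also bounds the position difference, so velocity
  -- differences change by at most `κ * D ≤ D / 2`. This can be absorbed: `D ≤ 2 * ‖w₁ 0 - w₂ 0‖`.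
  set D := ‖w₁ m - w₂ m‖ with hD
  have hDb : ∀ s ∈ Set.Icc (0 : ℝ) 1, ‖w₁ s - w₂ s‖ ≤ D := fun s hs ↦ hmax hs
  have hD0 : 0 ≤ D := norm_nonneg _
  have key : ∀ (f f' : ℝ → E) (C : ℝ),
      (∀ s ∈ Set.Icc (0 : ℝ) 1, HasDerivWithinAt f (f' s) (Set.Icc 0 1) s) →
      (∀ s ∈ Set.Icc (0 : ℝ) 1, ‖f' s‖ ≤ C) → 0 ≤ C →
      ∀ s ∈ Set.Icc (0 : ℝ) 1, ‖f s - f 0‖ ≤ C := by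
    intro f f' C hf hb hC s hs
    have := (convex_Icc (0 : ℝ) 1).norm_image_sub_le_of_norm_hasDerivWithin_le hf hb hmem0 hs
    refine this.trans ?_
    rw [sub_zero, Real.norm_eq_abs, abs_of_nonneg hs.1]
    exact mul_le_of_le_one_right hC hs.2
  have hu : ∀ s ∈ Set.Icc (0 : ℝ) 1, ‖u₁ s - u₂ s‖ ≤ D := by
    intro s hs
    have := key (fun s ↦ u₁ s - u₂ s) _ D (fun s hs ↦ (h₁.pos s hs).sub (h₂.pos s hs)) hDb hD0 s hs
    simpa [h0] using this
  have hw : ∀ s ∈ Set.Icc (0 : ℝ) 1, ‖w₁ s - w₂ s - (w₁ 0 - w₂ 0)‖ ≤ κ * D := by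
    refine key (fun s ↦ w₁ s - w₂ s) _ (κ * D) (fun s hs ↦ (h₁.vel s hs).sub (h₂.vel s hs))
      (fun s hs ↦ ?_) (by positivity)
    refine (hA _ (hu₁ s hs) _ (hu₂ s hs) _ (hw₁ s hs) _ (hw₂ s hs)).trans ?_
    gcongr
    exact max_le (hu s hs) (hDb s hs)
  have hDle : D ≤ 2 * ‖w₁ 0 - w₂ 0‖ := by
    have h1 := hw m hm
    have h2 := norm_le_norm_add_norm_sub (w₁ 0 - w₂ 0) (w₁ m - w₂ m)
    rw [norm_sub_rev (w₁ 0 - w₂ 0)] at h2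
    have h3 : κ * D ≤ 1 / 2 * D := by gcongr
    linarith
  have hw' : ∀ s ∈ Set.Icc (0 : ℝ) 1,
      ‖w₁ s - w₂ s - (w₁ 0 - w₂ 0)‖ ≤ 2 * κ * ‖w₁ 0 - w₂ 0‖ := fun s hs ↦
    (hw s hs).trans (by nlinarith)
  intro s hs
  refine ⟨hw' s hs, ?_⟩
  have := key (fun s ↦ u₁ s - u₂ s - s • (w₁ 0 - w₂ 0)) (fun s ↦ w₁ s - w₂ s - (w₁ 0 - w₂ 0))
    (2 * κ * ‖w₁ 0 - w₂ 0‖) (fun s hs ↦ ((h₁.pos s hs).sub (h₂.pos s hs)).sub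
      (by simpa using (hasDerivWithinAt_id s (Set.Icc (0 : ℝ) 1)).smul_const (w₁ 0 - w₂ 0)))
    hw' (by positivity) s hs
  simpa [h0] using this

/-- Solutions with small initial data exist on `[0,1]` and remain small. -/
theorem exists_isSpraySolution [CompleteSpace E] {A : E → E →L[ℝ] E →L[ℝ] E} {x₀ : E}
    (hA : ContDiffAt ℝ 1 A x₀) {r : ℝ} (hr : 0 < r) :
    ∃ δ > 0, ∀ q ∈ Metric.ball x₀ δ, ∀ v ∈ Metric.ball (0 : E) δ, ∃ u w : ℝ → E,
      IsSpraySolution A u w ∧ u 0 = q ∧ w 0 = v ∧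
      ∀ s ∈ Set.Icc (0 : ℝ) 1, u s ∈ Metric.ball x₀ r ∧ w s ∈ Metric.ball 0 r := by
  let F : E × E → E × E := fun z ↦ (z.2, A z.1 z.2 z.2)
  have hA' : ContDiffAt ℝ 1 (fun z : E × E ↦ A z.1) (x₀, 0) :=
    ContDiffAt.comp (g := A) (x₀, (0 : E)) hA contDiffAt_fst
  have hF : ContDiffAt ℝ 1 F (x₀, 0) :=
    contDiffAt_snd.prodMk ((hA'.clm_apply contDiffAt_snd).clm_apply contDiffAt_snd)
  obtain ⟨ε, hε, a, b, L, K, hb, hpl⟩ := IsPicardLindelof.of_contDiffAt_one hF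
  obtain ⟨α, hα, hαc⟩ := (hpl 0).exists_forall_mem_closedBall_eq_hasDerivWithinAt_continuousOn
  have hz : ((x₀, (0 : E)), (0 : ℝ)) ∈ Metric.closedBall (x₀, (0 : E)) b ×ˢ Set.Icc (0 - ε) (0 + ε) := by
    refine ⟨Metric.mem_closedBall_self b.2, ?_⟩
    constructor <;> simp [hε.le]
  have hα0 : α ((x₀, 0), 0) = (x₀, 0) := (hα (x₀, 0) hz.1).1
  have hnear := hαc _ hz
  rw [Metric.continuousWithinAt_iff] at hnear
  obtain ⟨η, hη, hnear⟩ := hnear r hr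
  rw [hα0] at hnear
  have hb' : (0 : ℝ) < b := hb
  -- The flow exists only up to time `ε`. By homogeneity of the equation, running it up to time `T`
  -- with initial velocity `T⁻¹ • v` and rescaling gives a solution on `[0,1]` with velocity `v`;
  -- hence the factor `T` in the radius.
  set T : ℝ := min (min ε 1) (η / 2) with hT
  have hT0 : 0 < T := by positivity
  have hTε : T ≤ ε := (min_le_left _ _).trans (min_le_left _ _)
  have hT1 : T ≤ 1 := (min_le_left _ _).trans (min_le_right _ _)
  have hTη : T < η := (min_le_right _ _).trans_lt (half_lt_self hη)
  refine ⟨min (b : ℝ) η * T, by positivity, fun q hq v hv ↦ ?_⟩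
  have hm : min (b : ℝ) η * T ≤ min (b : ℝ) η := mul_le_of_le_one_right (by positivity) hT1
  set z : E × E := (q, T⁻¹ • v) with hzdef
  have hv' : ‖T⁻¹ • v‖ < min (b : ℝ) η := by
    rw [norm_smul, norm_inv, Real.norm_eq_abs, abs_of_pos hT0, inv_mul_lt_iff₀ hT0, mul_comm]
    simpa using hv
  have hzd : dist z (x₀, 0) < min (b : ℝ) η := by
    rw [Prod.dist_eq, sup_lt_iff]
    exact ⟨lt_of_lt_of_le hq hm, by simpa [hzdef] using hv'⟩
  have hzb : z ∈ Metric.closedBall (x₀, (0 : E)) b := (hzd.le.trans (min_le_left _ _))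
  obtain ⟨hz0, hzder⟩ := hα z hzb
  have hTs : ∀ s ∈ Set.Icc (0 : ℝ) 1, T * s ∈ Set.Icc (0 - ε) (0 + ε) := by
    intro s hs
    have h1 : 0 ≤ T * s := mul_nonneg hT0.le hs.1
    have h2 : T * s ≤ T := mul_le_of_le_one_right hT0.le hs.2
    constructor <;> linarith
  have hder : ∀ s ∈ Set.Icc (0 : ℝ) 1, HasDerivWithinAt (fun s ↦ α (z, T * s))
      (T • F (α (z, T * s))) (Set.Icc 0 1) s := by
    intro s hs
    have h1 : HasDerivWithinAt (fun s : ℝ ↦ T * s) T (Set.Icc 0 1) s := by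
      simpa using (hasDerivWithinAt_id s (Set.Icc (0 : ℝ) 1)).const_mul T
    exact (hzder (T * s) (hTs s hs)).scomp s h1 (fun s hs ↦ hTs s hs)
  refine ⟨fun s ↦ (α (z, T * s)).1, fun s ↦ T • (α (z, T * s)).2, ⟨fun s hs ↦ ?_, fun s hs ↦ ?_⟩,
    ?_, ?_, fun s hs ↦ ?_⟩
  · exact (hder s hs).fst
  · have h1 : HasDerivWithinAt (fun s ↦ (α (z, T * s)).2) (T • (F (α (z, T * s))).2)
        (Set.Icc 0 1) s := (hder s hs).snd
    have h2 : HasDerivWithinAt (fun s ↦ T • (α (z, T * s)).2) (T • T • (F (α (z, T * s))).2)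
        (Set.Icc 0 1) s := h1.const_smul T
    simpa [F, smul_smul] using h2
  · simp only [mul_zero]
    exact congrArg Prod.fst hz0
  · simp only [mul_zero]
    rw [show α (z, 0) = z from hz0]
    exact smul_inv_smul₀ hT0.ne' v
  · have h1 : dist (α (z, T * s)) (x₀, 0) < r := by
      refine hnear ⟨hzb, hTs s hs⟩ ?_
      rw [Prod.dist_eq, sup_lt_iff]
      refine ⟨hzd.trans_le (min_le_right _ _), ?_⟩
      rw [Real.dist_eq, sub_zero, abs_of_nonneg (mul_nonneg hT0.le hs.1)]
      exact (mul_le_of_le_one_right hT0.le hs.2).trans_lt hTη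
    rw [Prod.dist_eq, sup_lt_iff] at h1
    refine ⟨h1.1, ?_⟩
    rw [mem_ball_zero_iff, norm_smul, Real.norm_eq_abs, abs_of_pos hT0]
    exact (mul_le_of_le_one_left (norm_nonneg _) hT1).trans_lt (by simpa using h1.2)

end Spray

/-! ### Linear algebra of Lorentz forms and its stability under perturbation. -/

section LorentzForm

set_option maxSynthPendingDepth 3

variable {E : Type*} [NormedAddCommGroup E] [NormedSpace ℝ E]

/-- A symmetric bilinear form that is positive definite on the orthogonal complement of every
timelike vector. -/
structure IsLorentzForm (B : E →L[ℝ] E →L[ℝ] ℝ) : Prop where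
  symm : ∀ v w, B v w = B w v
  pos : ∀ T v, B T T < 0 → B T v = 0 → v ≠ 0 → 0 < B v v

namespace IsLorentzForm

variable {B : E →L[ℝ] E →L[ℝ] ℝ} {T v w : E}

theorem eq_zero_of_causal (hB : IsLorentzForm B) (hT : B T T < 0) (hv : B v v ≤ 0) (h : B T v = 0) : v = 0 := by
  by_contra hne
  exact absurd (hB.pos T v hT h hne) (not_lt.2 hv)

/-- Causal vectors in the same time cone have negative product if one of them is timelike. -/
theorem apply_neg (hB : IsLorentzForm B) (hT : B T T < 0) (hv : B v v ≤ 0) (hTv : B T v < 0) (hw : B w w < 0)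
    (hTw : B T w < 0) : B v w < 0 := by
  -- With this `μ` the vector `v - μ • w` is orthogonal to `T`, so `B` is nonnegative on it;
  -- expanding the square gives the sign of `B v w`.
  set μ := B T v / B T w with hμ
  have hμ0 : 0 < μ := div_pos_of_neg_of_neg hTv hTw
  have h0 : B T (v - μ • w) = 0 := by
    rw [map_sub, map_smul, smul_eq_mul, hμ, div_mul_cancel₀ _ hTw.ne, sub_self]
  have h1 : 0 ≤ B (v - μ • w) (v - μ • w) := by
    by_cases h : v - μ • w = 0
    · simp [h]
    · exact (hB.pos T _ hT h0 h).le
  have h2 : B (v - μ • w) (v - μ • w) = B v v - 2 * μ * B v w + μ ^ 2 * B w w := by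
    simp only [map_sub, map_smul, sub_apply, smul_apply, smul_eq_mul, hB.symm w v]
    ring
  have h3 : μ ^ 2 * B w w < 0 := mul_neg_of_pos_of_neg (by positivity) hw
  by_contra hcon
  have : 0 ≤ 2 * μ * B v w := mul_nonneg (by positivity) (not_lt.1 hcon)
  linarith

/-- The sum of a causal vector and a timelike vector of the same time cone is timelike. -/
theorem add_timelike (hB : IsLorentzForm B) (hT : B T T < 0) (hv : B v v ≤ 0) (hTv : B T v < 0) (hw : B w w < 0)
    (hTw : B T w < 0) : B (v + w) (v + w) < 0 := by
  have h := hB.apply_neg hT hv hTv hw hTw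
  have : B (v + w) (v + w) = B v v + 2 * B v w + B w w := by
    simp only [map_add, add_apply, hB.symm w v]
    ring
  linarith

theorem injective (hB : IsLorentzForm B) (hT : B T T < 0) : Function.Injective B := by
  refine (injective_iff_map_eq_zero B).2 fun v hv ↦ ?_
  refine hB.eq_zero_of_causal hT (by simp [hv]) ?_
  rw [hB.symm, hv]
  rfl

/-- The form `B + k ⟨T, ·⟩²` is positive definite for a suitable `k`. -/
theorem exists_le_add_sq [FiniteDimensional ℝ E] (hB : IsLorentzForm B) (hT : B T T < 0) :
    ∃ c > 0, ∃ k > 0, ∀ v, c * ‖v‖ ^ 2 ≤ B v v + k * (B T v) ^ 2 := by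
  -- Splitting `v = n + a • T` with `n` orthogonal to `T`, this `k` turns the contribution `a ^ 2 *
  -- B T T` into its opposite.
  set k := 2 / (-B T T) with hk
  have hk0 : 0 < k := div_pos two_pos (neg_pos.2 hT)
  set P : E → ℝ := fun v ↦ B v v + k * (B T v) ^ 2 with hP
  have hpos : ∀ v, v ≠ 0 → 0 < P v := by
    intro v hv
    set a := B T v / B T T with ha
    have hTv : B T v = a * B T T := by rw [ha, div_mul_cancel₀ _ hT.ne]
    set n := v - a • T with hn
    have hTn : B T n = 0 := by simp [hn, hTv]
    have hv' : v = n + a • T := by simp [hn]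
    have hBv : B v v = B n n + a ^ 2 * B T T := by
      rw [hv']
      simp only [map_add, map_smul, add_apply, smul_apply, smul_eq_mul, hTn, hB.symm n T]
      ring
    have hPv : P v = B n n + a ^ 2 * (-B T T) := by
      have : k * (B T v) ^ 2 = 2 * a ^ 2 * (-B T T) := by
        rw [hTv, hk]
        field_simp
      simp only [hP]
      rw [this, hBv]
      ring
    rw [hPv]
    by_cases h : n = 0
    · have ha0 : a ≠ 0 := by
        rintro h0
        apply hv
        rw [hv', h, h0]
        simp
      have : 0 < a ^ 2 * (-B T T) := mul_pos (by positivity) (neg_pos.2 hT)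
      simpa [h] using this
    · have h1 := hB.pos T n hT hTn h
      have : 0 ≤ a ^ 2 * (-B T T) := mul_nonneg (by positivity) (neg_pos.2 hT).le
      linarith
  have hcont : Continuous P := by fun_prop
  rcases subsingleton_or_nontrivial E with hE | hE
  · refine ⟨1, one_pos, k, hk0, fun v ↦ ?_⟩
    simp [Subsingleton.elim v 0]
  have hne : (Metric.sphere (0 : E) 1).Nonempty := NormedSpace.sphere_nonempty.2 zero_le_one
  obtain ⟨m, hm, hmin⟩ := (isCompact_sphere (0 : E) 1).exists_isMinOn hne hcont.continuousOn
  have hm0 : m ≠ 0 := by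
    rintro rfl
    simp at hm
  refine ⟨P m, hpos m hm0, k, hk0, fun v ↦ ?_⟩
  by_cases hv : v = 0
  · simp [hv]
  have hvn : 0 < ‖v‖ := norm_pos_iff.2 hv
  have h1 : P m ≤ P (‖v‖⁻¹ • v) := hmin (by simp [norm_smul, hvn.ne'])
  have h2 : P v = ‖v‖ ^ 2 * P (‖v‖⁻¹ • v) := by
    simp only [hP, map_smul, smul_apply, smul_eq_mul]
    field_simp
  change P m * ‖v‖ ^ 2 ≤ P v
  rw [h2, mul_comm]
  gcongr

end IsLorentzForm

variable {G : E → E →L[ℝ] E →L[ℝ] ℝ} {x₀ T : E}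

/-- Near `x₀`, the function `-⟨T, ·⟩` controls the norm of future-pointing causal vectors. -/
theorem eventually_norm_le_of_causal [FiniteDimensional ℝ E] (hG : ContinuousAt G x₀)
    (hB : IsLorentzForm (G x₀)) (hT : G x₀ T T < 0) :
    ∃ c > 0, ∀ᶠ y in 𝓝 x₀, ∀ v, G y v v ≤ 0 → G y T v ≤ 0 → c * ‖v‖ ≤ -(G x₀ T v) := by
  obtain ⟨c, hc, k, hk, h⟩ := hB.exists_le_add_sq hT
  -- If `v` is causal at `y`, then `G x₀ v v ≤ c / 2 * ‖v‖ ^ 2`, leaving `c / 2 * ‖v‖ ^ 2 ≤ k * (G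
  -- x₀ T v) ^ 2`.
  set d := Real.sqrt (c / 2 / k) with hd
  have hd0 : 0 < d := Real.sqrt_pos.2 (by positivity)
  refine ⟨d, hd0, ?_⟩
  have h1 : ∀ᶠ y in 𝓝 x₀, ‖G y - G x₀‖ < c / 2 := by
    filter_upwards [hG.eventually (Metric.ball_mem_nhds _ (half_pos hc))] with y hy
    rwa [← dist_eq_norm]
  have h2 : ∀ᶠ y in 𝓝 x₀, ‖G y T - G x₀ T‖ < d / 2 := by
    have hGT : ContinuousAt (fun y ↦ G y T) x₀ := hG.clm_apply continuousAt_const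
    filter_upwards [hGT.eventually (Metric.ball_mem_nhds _ (half_pos hd0))] with y hy
    rwa [← dist_eq_norm]
  filter_upwards [h1, h2] with y hy1 hy2 v hv hTv
  have h3 : |G y v v - G x₀ v v| ≤ c / 2 * ‖v‖ ^ 2 := by
    have := (G y - G x₀).le_opNorm₂ v v
    simp only [sub_apply, Real.norm_eq_abs] at this
    refine this.trans ?_
    rw [mul_assoc, ← sq]
    gcongr
  have h4 : |G y T v - G x₀ T v| ≤ d / 2 * ‖v‖ := by
    have := (G y T - G x₀ T).le_opNorm v
    simp only [sub_apply, Real.norm_eq_abs] at this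
    exact this.trans (by gcongr)
  have h5 : d ^ 2 * ‖v‖ ^ 2 ≤ (G x₀ T v) ^ 2 := by
    rw [hd, Real.sq_sqrt (by positivity), div_mul_eq_mul_div, div_le_iff₀ hk]
    have := h v
    rw [abs_le] at h3
    linarith
  have h6 : d * ‖v‖ ≤ |G x₀ T v| := by
    rw [← mul_pow, ← sq_abs (G x₀ T v)] at h5
    exact (sq_le_sq₀ (by positivity) (abs_nonneg _)).1 h5
  -- The sign of `G x₀ T v` is settled by `G y T v ≤ 0`: the two differ by at most `d / 2 * ‖v‖`, so
  -- a positive value would force `v = 0`.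
  rcases le_abs.1 h6 with h7 | h7
  · rw [abs_le] at h4
    have hv0 : 0 ≤ d * ‖v‖ := by positivity
    have : d * ‖v‖ ≤ d / 2 * ‖v‖ := by linarith
    have hz : d * ‖v‖ ≤ 0 := by linarith
    have : v = 0 := by
      have h8 := nonpos_of_mul_nonpos_right hz hd0
      exact norm_le_zero_iff.1 h8
    simp [this]
  · exact h7

/-- Vectors close to a timelike vector are timelike and in the same time cone. -/
theorem exists_eventually_timelike (hG : ContinuousAt G x₀) (hT : G x₀ T T < 0) :
    ∃ ε > 0, ∀ᶠ y in 𝓝 x₀, ∀ e, ‖e - T‖ < ε → G y e e < 0 ∧ G y T e < 0 := by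
  have hG' : ContinuousAt (fun z : E × E ↦ G z.1) (x₀, T) :=
    ContinuousAt.comp (g := G) hG continuousAt_fst
  have h1 : ContinuousAt (fun z : E × E ↦ G z.1 z.2 z.2) (x₀, T) :=
    (hG'.clm_apply continuousAt_snd).clm_apply continuousAt_snd
  have h2 : ContinuousAt (fun z : E × E ↦ G z.1 T z.2) (x₀, T) :=
    (hG'.clm_apply continuousAt_const).clm_apply continuousAt_snd
  have h3 := (h1.eventually_lt_const hT).and (h2.eventually_lt_const hT)
  rw [nhds_prod_eq] at h3
  obtain ⟨P, hP, Q, hQ, h⟩ := Filter.eventually_prod_iff.1 h3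
  obtain ⟨ε, hε, hQ⟩ := Metric.eventually_nhds_iff.1 hQ
  refine ⟨ε, hε, hP.mono fun y hy e he ↦ h hy (hQ ?_)⟩
  rwa [dist_eq_norm]

end LorentzForm

/-! ### A priori bound on the velocity of causal geodesics. -/

section APriori

set_option maxSynthPendingDepth 3

variable {E : Type*} [NormedAddCommGroup E] [NormedSpace ℝ E]

/-- A solution of the spray equation whose velocity is controlled by a linear function `ℓ` has
small velocity if `ℓ` varies little along it. -/
theorem IsSpraySolution.velocity_le {A : E → E →L[ℝ] E →L[ℝ] E} {u w : ℝ → E}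
    (h : IsSpraySolution A u w) {ℓ : E →L[ℝ] ℝ} {c K Δ : ℝ} (hc : 0 < c) (hK : 0 ≤ K)
    (hA : ∀ s ∈ Set.Icc (0 : ℝ) 1, ‖A (u s)‖ ≤ K)
    (hℓ : ∀ s ∈ Set.Icc (0 : ℝ) 1, c * ‖w s‖ ≤ ℓ (w s))
    (hΔ : ∀ s ∈ Set.Icc (0 : ℝ) 1, ∀ s' ∈ Set.Icc (0 : ℝ) 1, ℓ (u s) - ℓ (u s') ≤ Δ) :
    ∀ s ∈ Set.Icc (0 : ℝ) 1, c * ‖w s‖ ≤ Δ * Real.exp (‖ℓ‖ * K / c ^ 2 * Δ) := by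
  set k := ‖ℓ‖ * K / c ^ 2 with hk
  have hk0 : 0 ≤ k := by positivity
  have hu : ∀ s ∈ Set.Icc (0 : ℝ) 1, HasDerivWithinAt (fun s ↦ ℓ (u s)) (ℓ (w s)) (Set.Icc 0 1) s :=
    fun s hs ↦ ℓ.hasFDerivAt.comp_hasDerivWithinAt s (h.pos s hs)
  have hw : ∀ s ∈ Set.Icc (0 : ℝ) 1, HasDerivWithinAt (fun s ↦ ℓ (w s)) (ℓ (A (u s) (w s) (w s)))
      (Set.Icc 0 1) s :=
    fun s hs ↦ ℓ.hasFDerivAt.comp_hasDerivWithinAt s (h.vel s hs)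
  have hnn : ∀ s ∈ Set.Icc (0 : ℝ) 1, 0 ≤ ℓ (w s) := fun s hs ↦
    (by positivity : 0 ≤ c * ‖w s‖).trans (hℓ s hs)
  -- With `f = ℓ ∘ u` this reads `|f''| ≤ k * f' ^ 2`, a logarithmic derivative bound `|(log f')'| ≤
  -- k * f'`. Hence `f' * exp (k * f)` increases and `f' * exp (-k * f)` decreases; this form avoids
  -- dividing by `f'`.
  have hacc : ∀ s ∈ Set.Icc (0 : ℝ) 1, |ℓ (A (u s) (w s) (w s))| ≤ k * ℓ (w s) ^ 2 := by
    intro s hs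
    have h1 : ‖w s‖ ≤ ℓ (w s) / c := by rw [le_div_iff₀ hc, mul_comm]; exact hℓ s hs
    calc |ℓ (A (u s) (w s) (w s))| ≤ ‖ℓ‖ * ‖A (u s) (w s) (w s)‖ := ℓ.le_opNorm _
      _ ≤ ‖ℓ‖ * (‖A (u s)‖ * ‖w s‖ * ‖w s‖) := by gcongr; exact (A (u s)).le_opNorm₂ _ _
      _ ≤ ‖ℓ‖ * (K * (ℓ (w s) / c) * (ℓ (w s) / c)) := by
        gcongr
        · exact mul_nonneg hK (div_nonneg (hnn s hs) hc.le)
        · exact hA s hs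
      _ = k * ℓ (w s) ^ 2 := by rw [hk]; field_simp
  have hat : ∀ {f : ℝ → ℝ} {f' s : ℝ}, s ∈ interior (Set.Icc (0 : ℝ) 1) →
      HasDerivWithinAt f f' (Set.Icc 0 1) s → HasDerivWithinAt f f' (interior (Set.Icc 0 1)) s :=
    fun _ hf ↦ hf.mono interior_subset
  have hmono : MonotoneOn (fun s ↦ ℓ (w s) * Real.exp (k * ℓ (u s))) (Set.Icc 0 1) := by
    have hd : ∀ s ∈ Set.Icc (0 : ℝ) 1, HasDerivWithinAt
        (fun s ↦ ℓ (w s) * Real.exp (k * ℓ (u s))) (ℓ (A (u s) (w s) (w s)) * Real.exp (k * ℓ (u s))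
          + ℓ (w s) * (Real.exp (k * ℓ (u s)) * (k * ℓ (w s)))) (Set.Icc 0 1) s :=
      fun s hs ↦ (hw s hs).mul ((hu s hs).const_mul k).exp
    refine monotoneOn_of_hasDerivWithinAt_nonneg (convex_Icc 0 1)
      (fun s hs ↦ (hd s hs).continuousWithinAt) (fun s hs ↦ hat hs (hd s (interior_subset hs)))
      fun s hs ↦ ?_
    have h1 := (abs_le.1 (hacc s (interior_subset hs))).1
    have h2 := Real.exp_pos (k * ℓ (u s))
    nlinarith
  have hanti : AntitoneOn (fun s ↦ ℓ (w s) * Real.exp (-k * ℓ (u s))) (Set.Icc 0 1) := by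
    have hd : ∀ s ∈ Set.Icc (0 : ℝ) 1, HasDerivWithinAt
        (fun s ↦ ℓ (w s) * Real.exp (-k * ℓ (u s)))
        (ℓ (A (u s) (w s) (w s)) * Real.exp (-k * ℓ (u s))
          + ℓ (w s) * (Real.exp (-k * ℓ (u s)) * (-k * ℓ (w s)))) (Set.Icc 0 1) s :=
      fun s hs ↦ (hw s hs).mul ((hu s hs).const_mul (-k)).exp
    refine antitoneOn_of_hasDerivWithinAt_nonpos (convex_Icc 0 1)
      (fun s hs ↦ (hd s hs).continuousWithinAt) (fun s hs ↦ hat hs (hd s (interior_subset hs)))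
      fun s hs ↦ ?_
    have h1 := (abs_le.1 (hacc s (interior_subset hs))).2
    have h2 := Real.exp_pos (-k * ℓ (u s))
    nlinarith
  -- At a mean value point `ℓ (w m)` equals the total increment of `ℓ ∘ u`, at most `Δ`; the two
  -- monotone quantities carry this bound to both sides of `m`.
  obtain ⟨m, hm, hm'⟩ := exists_hasDerivAt_eq_slope (fun s ↦ ℓ (u s)) (fun s ↦ ℓ (w s))
    zero_lt_one (fun s hs ↦ (hu s hs).continuousWithinAt)
    (fun s hs ↦ (hu s (Set.Ioo_subset_Icc_self hs)).hasDerivAt (Icc_mem_nhds hs.1 hs.2))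
  have hmI : m ∈ Set.Icc (0 : ℝ) 1 := Set.Ioo_subset_Icc_self hm
  have hmle : ℓ (w m) ≤ Δ := by
    rw [hm']
    simpa using hΔ 1 (by simp) 0 (by simp)
  intro s hs
  refine (hℓ s hs).trans ?_
  have hfin : ∀ a b : ℝ, a - b ≤ k * Δ → ℓ (w s) * Real.exp b ≤ ℓ (w m) * Real.exp a →
      ℓ (w s) ≤ Δ * Real.exp (k * Δ) := by
    intro a b hab hle
    have h1 : ℓ (w s) ≤ ℓ (w m) * Real.exp (a - b) := by
      rw [Real.exp_sub, mul_div_assoc', le_div_iff₀ (Real.exp_pos _)]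
      exact hle
    refine h1.trans ?_
    gcongr
    exact (hnn m hmI).trans hmle
  rcases le_total s m with hsm | hsm
  · refine hfin _ _ ?_ (hmono hs hmI hsm)
    rw [← mul_sub]
    exact mul_le_mul_of_nonneg_left (hΔ m hmI s hs) hk0
  · refine hfin _ _ ?_ (hanti hmI hs hsm)
    have := mul_le_mul_of_nonneg_left (hΔ s hs m hmI) hk0
    linarith

end APriori

/-! ### The geodesic spray of a metric. -/

section Spray

set_option maxSynthPendingDepth 3

variable {E : Type*} [NormedAddCommGroup E] [NormedSpace ℝ E]

/-- The Christoffel symbols of the first kind of a metric `G` on a vector space. -/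
noncomputable def metricChristoffel (G : E → E →L[ℝ] E →L[ℝ] ℝ) (y a b w : E) : ℝ :=
  (fderiv ℝ G y a b w + fderiv ℝ G y b a w - fderiv ℝ G y w a b) / 2

/-- Exchanging the arguments of a bilinear form, as a continuous linear map. -/
noncomputable def flipBilin (E : Type*) [NormedAddCommGroup E] [NormedSpace ℝ E] :
    (E →L[ℝ] E →L[ℝ] ℝ) →L[ℝ] E →L[ℝ] E →L[ℝ] ℝ :=
  (ContinuousLinearMap.flipₗᵢ ℝ E E ℝ).toContinuousLinearEquiv.toContinuousLinearMap

@[simp]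
theorem flipBilin_apply (B : E →L[ℝ] E →L[ℝ] ℝ) (v w : E) : flipBilin E B v w = B w v := rfl

/-- The Christoffel symbols of the first kind as a bilinear map into the dual space. -/
noncomputable def metricChristoffelMap (G : E → E →L[ℝ] E →L[ℝ] ℝ) (y : E) :
    E →L[ℝ] E →L[ℝ] E →L[ℝ] ℝ :=
  (1 / 2 : ℝ) • (fderiv ℝ G y + (fderiv ℝ G y).flip
    - flipBilin E ∘L (fderiv ℝ G y).flip)

theorem metricChristoffelMap_apply (G : E → E →L[ℝ] E →L[ℝ] ℝ) (y a b w : E) :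
    metricChristoffelMap G y a b w = metricChristoffel G y a b w := by
  simp [metricChristoffelMap, metricChristoffel]
  ring

/-- The geodesic spray of a metric: geodesics solve `u'' = A(u)(u', u')`. -/
noncomputable def geodesicSpray (G : E → E →L[ℝ] E →L[ℝ] ℝ) (y : E) : E →L[ℝ] E →L[ℝ] E :=
  -(ContinuousLinearMap.compL ℝ E (E →L[ℝ] ℝ) E (G y).inverse ∘L metricChristoffelMap G y)

theorem isInvertible_of_injective [FiniteDimensional ℝ E] {B : E →L[ℝ] E →L[ℝ] ℝ}
    (hB : Function.Injective B) : B.IsInvertible := by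
  have hd : Module.finrank ℝ E = Module.finrank ℝ (E →L[ℝ] ℝ) := by
    rw [← (LinearMap.toContinuousLinearMap (𝕜 := ℝ) (E := E) (F' := ℝ)).finrank_eq]
    exact (Subspace.dual_finrank_eq (K := ℝ) (V := E)).symm
  have := FiniteDimensional.complete ℝ E
  let e := LinearEquiv.ofInjectiveOfFinrankEq (B : E →ₗ[ℝ] E →L[ℝ] ℝ) hB hd
  refine ⟨e.toContinuousLinearEquiv, ?_⟩
  ext v w
  rfl

/-- Raising the index needs invertibility, because `ContinuousLinearMap.inverse` takes the value 0
on maps that are not invertible. -/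
theorem geodesicSpray_eq_iff {G : E → E →L[ℝ] E →L[ℝ] ℝ} {y : E} (hG : (G y).IsInvertible)
    (a b : E) : (∀ w, G y b w + metricChristoffel G y a a w = 0) ↔ b = geodesicSpray G y a a := by
  have h1 : geodesicSpray G y a a = -(G y).inverse (metricChristoffelMap G y a a) := rfl
  rw [h1]
  obtain ⟨e, he⟩ := hG
  rw [← he, ContinuousLinearMap.inverse_equiv]
  constructor
  · intro h
    have : e b = -metricChristoffelMap G y a a := by
      ext w
      have := h w
      simp [metricChristoffelMap_apply]
      simp at this
      linarith
    rw [ContinuousLinearEquiv.coe_coe, ← map_neg, ← this, e.symm_apply_apply]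
  · rintro rfl w
    simp [metricChristoffelMap_apply]

/-- One derivative of `G` is lost to the Christoffel symbols; C¹ is what the Lipschitz estimate and
Picard–Lindelöf use. -/
theorem contDiffAt_geodesicSpray [CompleteSpace E] {G : E → E →L[ℝ] E →L[ℝ] ℝ} {x₀ : E}
    (hG : ContDiffAt ℝ 2 G x₀) (hi : (G x₀).IsInvertible) :
    ContDiffAt ℝ 1 (geodesicSpray G) x₀ := by
  have hD : ContDiffAt ℝ 1 (fderiv ℝ G) x₀ := hG.fderiv_right (by norm_num)
  have hflip : ContDiffAt ℝ 1 (fun y ↦ (fderiv ℝ G y).flip) x₀ :=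
    (ContinuousLinearMap.flipₗᵢ ℝ E E (E →L[ℝ] ℝ)).contDiff.contDiffAt.comp x₀ hD
  have hΓ : ContDiffAt ℝ 1 (metricChristoffelMap G) x₀ := by
    have h3 : ContDiffAt ℝ 1 (fun y ↦ flipBilin E ∘L
        (fderiv ℝ G y).flip) x₀ := contDiffAt_const.clm_comp hflip
    exact ((hD.add hflip).sub h3).const_smul (1 / 2 : ℝ)
  have hinv : ContDiffAt ℝ 1 (fun y ↦ (G y).inverse) x₀ := by
    obtain ⟨e, he⟩ := hi
    have h := contDiffAt_map_inverse (𝕜 := ℝ) (n := 1) e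
    rw [he] at h
    exact h.comp x₀ (hG.of_le (by norm_num))
  refine ContDiffAt.neg (ContDiffAt.clm_comp ?_ hΓ)
  exact (ContinuousLinearMap.compL ℝ E (E →L[ℝ] ℝ) E).contDiff.contDiffAt.comp x₀ hinv

/-- Geodesics have constant speed. -/
theorem hasDerivWithinAt_speed {G : E → E →L[ℝ] E →L[ℝ] ℝ} {u w : ℝ → E} {a : E} {J : Set ℝ} {s : ℝ}
    (hG : DifferentiableAt ℝ G (u s)) (hsymm : ∀ v w, G (u s) v w = G (u s) w v)
    (hu : HasDerivWithinAt u (w s) J s) (hw : HasDerivWithinAt w a J s)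
    (hgeo : ∀ x, G (u s) a x + metricChristoffel G (u s) (w s) (w s) x = 0) :
    HasDerivWithinAt (fun r ↦ G (u r) (w r) (w r)) 0 J s := by
  have h1 : HasDerivWithinAt (fun r ↦ G (u r)) (fderiv ℝ G (u s) (w s)) J s :=
    hG.hasFDerivAt.comp_hasDerivWithinAt s hu
  have h2 := (h1.clm_apply hw).clm_apply hw
  refine h2.congr_deriv ?_
  -- Tested on the velocity itself, the Christoffel term is half the derivative of `G` along the
  -- curve.
  have h3 := hgeo (w s)
  simp only [metricChristoffel] at h3
  simp only [add_apply, hsymm (w s) a]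
  linarith

end Spray

/-! ### Uniqueness of null rays. -/

section NullRay

set_option maxSynthPendingDepth 3

variable {E : Type*} [NormedAddCommGroup E] [NormedSpace ℝ E]

/-- A lightlike geodesic `u : [0,1] → V` with velocity `w` of the metric `G`, in the time cone of
`T`, from `q` to a point of `S`. -/
structure IsNullRay (G : E → E →L[ℝ] E →L[ℝ] ℝ) (T : E) (V S : Set E) (q : E) (u w : ℝ → E) :
    Prop where
  pos : ∀ s ∈ Set.Icc (0 : ℝ) 1, HasDerivWithinAt u (w s) (Set.Icc 0 1) s
  acc : ∀ s ∈ Set.Icc (0 : ℝ) 1, ∃ a, HasDerivWithinAt w a (Set.Icc 0 1) s ∧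
    ∀ x, G (u s) a x + metricChristoffel G (u s) (w s) (w s) x = 0
  null : ∀ s ∈ Set.Icc (0 : ℝ) 1, G (u s) (w s) (w s) = 0
  future : ∀ s ∈ Set.Icc (0 : ℝ) 1, G (u s) T (w s) < 0
  start : u 0 = q
  finish : u 1 ∈ S
  stays : ∀ s ∈ Set.Icc (0 : ℝ) 1, u s ∈ V

theorem IsNullRay.mono {G : E → E →L[ℝ] E →L[ℝ] ℝ} {T : E} {V V' S : Set E} {q : E} {u w : ℝ → E}
    (h : IsNullRay G T V S q u w) (hV : V ⊆ V') : IsNullRay G T V' S q u w :=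
  { h with stays := fun s hs ↦ hV (h.stays s hs) }

theorem IsNullRay.isSpraySolution {G : E → E →L[ℝ] E →L[ℝ] ℝ} {T : E} {V S : Set E} {q : E}
    {u w : ℝ → E} (h : IsNullRay G T V S q u w) (hV : ∀ y ∈ V, (G y).IsInvertible) :
    IsSpraySolution (geodesicSpray G) u w where
  pos := h.pos
  vel s hs := by
    obtain ⟨a, ha, hgeo⟩ := h.acc s hs
    rwa [← (geodesicSpray_eq_iff (hV _ (h.stays s hs)) _ _).1 hgeo]

/-- A vector `d` close, with small relative error, to a vector that is nearly `h • T` is itself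
nearly `h • T`. -/
theorem exists_eq_smul_near (T : E) {ε : ℝ} (hε : 0 < ε) :
    ∃ κ > 0, κ ≤ 1 / 4 ∧ ∃ c > 0, ∀ h > 0, ∀ b d : E, ‖b - h • T‖ ≤ c * h →
      ‖b - d‖ ≤ 2 * κ * ‖d‖ → ∃ e, ‖e - T‖ < ε ∧ d = h • e := by
  -- The errors add up to `2 * κ * ‖d‖ + c * h ≤ ε / 2 * h + ε / 4 * h < ε * h`, using `‖d‖ ≤ 2 *
  -- ‖b‖ ≤ 2 * (‖T‖ + c) * h`.
  set c := ε / 4 with hc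
  set κ := min (1 / 4) (ε / (8 * (‖T‖ + c))) with hκ
  have hc0 : 0 < c := by positivity
  have hκ0 : 0 < κ := by positivity
  have hκ1 : κ ≤ 1 / 4 := min_le_left _ _
  have hκ2 : κ * (8 * (‖T‖ + c)) ≤ ε := by
    rw [← le_div_iff₀ (by positivity)]
    exact min_le_right _ _
  refine ⟨κ, hκ0, hκ1, c, hc0, fun h hh b d hb hd ↦ ⟨h⁻¹ • d, ?_, ?_⟩⟩
  · have h1 : ‖b‖ ≤ (‖T‖ + c) * h := by
      have := norm_le_norm_add_norm_sub (h • T) b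
      rw [norm_smul, Real.norm_eq_abs, abs_of_pos hh, norm_sub_rev] at this
      linarith
    have h2 : ‖d‖ ≤ 2 * ‖b‖ := by
      have := norm_le_norm_add_norm_sub b d
      have h3 : 2 * κ * ‖d‖ ≤ 1 / 2 * ‖d‖ := by
        gcongr
        linarith
      linarith
    have h3 : ‖d - h • T‖ ≤ 2 * κ * ‖d‖ + c * h := by
      have := norm_sub_le_norm_sub_add_norm_sub d b (h • T)
      rw [norm_sub_rev d b] at this
      linarith
    have h4 : 2 * κ * ‖d‖ ≤ ε / 2 * h := by
      calc 2 * κ * ‖d‖ ≤ 2 * κ * (2 * ((‖T‖ + c) * h)) := by gcongr; linarith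
        _ = κ * (8 * (‖T‖ + c)) * (h / 2) := by ring
        _ ≤ ε * (h / 2) := by gcongr
        _ = ε / 2 * h := by ring
    have h5 : h⁻¹ • d - T = h⁻¹ • (d - h • T) := by
      rw [smul_sub, inv_smul_smul₀ hh.ne']
    rw [h5, norm_smul, norm_inv, Real.norm_eq_abs, abs_of_pos hh, inv_mul_lt_iff₀ hh]
    have : c * h = ε / 4 * h := by rw [hc]
    have : 0 < ε * h := by positivity
    linarith
  · rw [smul_inv_smul₀ hh.ne']

variable {G : E → E →L[ℝ] E →L[ℝ] ℝ} {x₀ T : E} {β : ℝ → E} {t₀ : ℝ} {S : Set E}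

/-- Strictness matters: both endpoints of the chord vary, as in comparing two arrival points. -/
theorem HasStrictDerivAt.exists_norm_sub_sub_le (hβ : HasStrictDerivAt β T t₀) {c : ℝ}
    (hc : 0 < c) : ∃ η > 0, ∀ t₁ t₂, |t₁ - t₀| < η → |t₂ - t₀| < η →
      ‖β t₂ - β t₁ - (t₂ - t₁) • T‖ ≤ c * |t₂ - t₁| := by
  have := hβ.isLittleO.def hc
  obtain ⟨η, hη, h⟩ := Metric.eventually_nhds_iff.1 this
  refine ⟨η, hη, fun t₁ t₂ h₁ h₂ ↦ ?_⟩
  have := @h (t₂, t₁) (by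
    rw [Prod.dist_eq, sup_lt_iff]
    exact ⟨h₂, h₁⟩)
  simpa using this

/-- Null rays in a small ball from a given point to a timelike curve are unique. -/
theorem exists_ball_nullRay_unique [FiniteDimensional ℝ E] (hG : ContDiffAt ℝ 2 G x₀)
    (hL : ∀ᶠ y in 𝓝 x₀, IsLorentzForm (G y)) (hT : G x₀ T T < 0) (hβ : HasStrictDerivAt β T t₀)
    (hS : ∀ η > 0, ∀ᶠ x in 𝓝 x₀, x ∈ S → ∃ t, |t - t₀| < η ∧ β t = x) :
    ∃ R > 0, ∀ q u w u' w', IsNullRay G T (Metric.ball x₀ R) S q u w →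
      IsNullRay G T (Metric.ball x₀ R) S q u' w' → Set.EqOn u' u (Set.Icc 0 1) := by
  have := FiniteDimensional.complete ℝ E
  have hGc := hG.continuousAt
  obtain ⟨ε, hε, hN₁⟩ := exists_eventually_timelike hGc hT
  obtain ⟨κ, hκ, hκ4, c, hc, hcone⟩ := exists_eq_smul_near T hε
  obtain ⟨η, hη, hβη⟩ := hβ.exists_norm_sub_sub_le hc
  have hi : (G x₀).IsInvertible := isInvertible_of_injective (hL.self_of_nhds.injective hT)
  have hA := contDiffAt_geodesicSpray hG hi
  obtain ⟨ρ, hρ, hlip⟩ := exists_spray_lipschitz hA hκ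
  obtain ⟨c₁, hc₁, hN₂⟩ := eventually_norm_le_of_causal hGc hL.self_of_nhds hT
  set K := ‖geodesicSpray G x₀‖ + 1 with hK
  have hN₃ : ∀ᶠ y in 𝓝 x₀, ‖geodesicSpray G y‖ ≤ K :=
    (hA.continuousAt.norm.eventually_lt_const (lt_add_one _)).mono fun _ h ↦ h.le
  obtain ⟨R₁, hR₁, hN⟩ := Metric.eventually_nhds_iff_ball.1
    (hN₁.and (hN₂.and (hN₃.and ((hS η hη).and hL))))
  set ℓ : E →L[ℝ] ℝ := -(G x₀ T) with hℓ
  set k := ‖ℓ‖ * K / c₁ ^ 2 with hk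
  -- The a priori velocity bound with `Δ = ‖ℓ‖ * (2 * R)`, the variation of `ℓ` on a ball of radius
  -- `R`, tends to 0 with `R`. A small enough `R` therefore forces all velocities below `ρ`.
  have hlim : Filter.Tendsto (fun R : ℝ ↦ ‖ℓ‖ * (2 * R) * Real.exp (k * (‖ℓ‖ * (2 * R))))
      (𝓝[>] 0) (𝓝 0) := by
    have : Continuous (fun R : ℝ ↦ ‖ℓ‖ * (2 * R) * Real.exp (k * (‖ℓ‖ * (2 * R)))) := by fun_prop
    have := this.tendsto 0
    simp only [mul_zero, zero_mul] at this
    exact this.mono_left nhdsWithin_le_nhds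
  have hRev : ∀ᶠ R : ℝ in 𝓝[>] 0, 0 < R ∧ R ≤ R₁ ∧ R ≤ ρ := by
    filter_upwards [Ioc_mem_nhdsGT hR₁, Ioc_mem_nhdsGT hρ] with R h1 h2
    exact ⟨h1.1, h1.2, h2.2⟩
  obtain ⟨R, hRlt, hRpos, hRR₁, hRρ⟩ :=
    ((hlim.eventually_lt_const (mul_pos hc₁ hρ)).and hRev).exists
  have hsub₁ : Metric.ball x₀ R ⊆ Metric.ball x₀ R₁ := Metric.ball_subset_ball hRR₁
  have hsubρ : Metric.ball x₀ R ⊆ Metric.ball x₀ ρ := Metric.ball_subset_ball hRρ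
  have hTy : ∀ y ∈ Metric.ball x₀ R, G y T T < 0 := fun y hy ↦
    ((hN y (hsub₁ hy)).1 T (by simpa using hε)).1
  have hLy : ∀ y ∈ Metric.ball x₀ R, IsLorentzForm (G y) := fun y hy ↦ (hN y (hsub₁ hy)).2.2.2.2
  have hinv : ∀ y ∈ Metric.ball x₀ R, (G y).IsInvertible := fun y hy ↦
    isInvertible_of_injective ((hLy y hy).injective (hTy y hy))
  have hvel : ∀ q u w, IsNullRay G T (Metric.ball x₀ R) S q u w →
      ∀ s ∈ Set.Icc (0 : ℝ) 1, w s ∈ Metric.ball (0 : E) ρ := by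
    intro q u w h s hs
    have := (h.isSpraySolution hinv).velocity_le (ℓ := ℓ) (c := c₁) (K := K) (Δ := ‖ℓ‖ * (2 * R)) hc₁
      (by positivity) (fun s hs ↦ (hN _ (hsub₁ (h.stays s hs))).2.2.1)
      (fun s hs ↦ (hN _ (hsub₁ (h.stays s hs))).2.1 _ (h.null s hs).le (h.future s hs).le) ?_ s hs
    · rw [mem_ball_zero_iff]
      exact lt_of_mul_lt_mul_left (this.trans_lt hRlt) hc₁.le
    · intro s hs s' hs'
      rw [← map_sub]
      refine (le_abs_self _).trans ((ℓ.le_opNorm _).trans ?_)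
      gcongr
      have h1 := h.stays s hs
      have h2 := h.stays s' hs'
      rw [mem_ball_iff_norm] at h1 h2
      have := norm_sub_le_norm_sub_add_norm_sub (u s) x₀ (u s')
      rw [norm_sub_rev x₀] at this
      linarith
  have hdiff : ∀ q u w u' w', IsNullRay G T (Metric.ball x₀ R) S q u w →
      IsNullRay G T (Metric.ball x₀ R) S q u' w' → ∀ s ∈ Set.Icc (0 : ℝ) 1,
      ‖u s - u' s - s • (w 0 - w' 0)‖ ≤ 2 * κ * ‖w 0 - w' 0‖ := by
    intro q u w u' w' h h' s hs
    exact (IsSpraySolution.norm_sub_sub_le (by linarith) hlip hκ (h.isSpraySolution hinv)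
      (h'.isSpraySolution hinv) (fun s hs ↦ hsubρ (h.stays s hs)) (hvel q u w h)
      (fun s hs ↦ hsubρ (h'.stays s hs)) (hvel q u' w' h') (h.start.trans h'.start.symm) s hs).2
  have hmem1 : (1 : ℝ) ∈ Set.Icc (0 : ℝ) 1 := by simp
  have hmem0 : (0 : ℝ) ∈ Set.Icc (0 : ℝ) 1 := by simp
  -- The later ray would have initial velocity `w 0` plus a timelike vector of the same cone, hence
  -- a timelike one.
  have hnlt : ∀ q u w u' w' t t', IsNullRay G T (Metric.ball x₀ R) S q u w →
      IsNullRay G T (Metric.ball x₀ R) S q u' w' → |t - t₀| < η → |t' - t₀| < η → β t = u 1 →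
      β t' = u' 1 → ¬ t < t' := by
    intro q u w u' w' t t' h h' ht ht' htu htu' hlt
    have hq : q ∈ Metric.ball x₀ R := h.start ▸ h.stays 0 hmem0
    have h1 := hdiff q u' w' u w h' h 1 hmem1
    rw [one_smul, ← htu, ← htu'] at h1
    have h2 := hβη t t' ht ht'
    rw [abs_of_pos (sub_pos.2 hlt)] at h2
    obtain ⟨e, he, hde⟩ := hcone (t' - t) (sub_pos.2 hlt) _ _ h2 h1
    have h3 := (hN q (hsub₁ hq)).1 e he
    have hpos := sub_pos.2 hlt
    have h4 := h.null 0 hmem0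
    have h5 := h.future 0 hmem0
    have h6 := h'.null 0 hmem0
    rw [h.start] at h4 h5
    rw [h'.start] at h6
    have h7 := (hLy q hq).add_timelike (hTy q hq) h4.le h5 (w := (t' - t) • e)
      (by
        simp only [map_smul, smul_apply, smul_eq_mul]
        exact mul_neg_of_pos_of_neg hpos (mul_neg_of_pos_of_neg hpos h3.1))
      (by
        simp only [map_smul, smul_eq_mul]
        exact mul_neg_of_pos_of_neg hpos h3.2)
    rw [← hde, add_sub_cancel, h6] at h7
    exact lt_irrefl _ h7
  refine ⟨R, hRpos, fun q u w u' w' h h' ↦ ?_⟩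
  obtain ⟨t, ht, htu⟩ := (hN _ (hsub₁ (h.stays 1 hmem1))).2.2.2.1 h.finish
  obtain ⟨t', ht', htu'⟩ := (hN _ (hsub₁ (h'.stays 1 hmem1))).2.2.2.1 h'.finish
  have htt : t = t' := le_antisymm (not_lt.1 (hnlt q u' w' u w t' t h' h ht' ht htu' htu))
    (not_lt.1 (hnlt q u w u' w' t t' h h' ht ht' htu htu'))
  have h1 := hdiff q u' w' u w h' h 1 hmem1
  rw [← htu, ← htu', htt, sub_self, one_smul, zero_sub, norm_neg] at h1
  -- With a common end point the estimate reads `‖x‖ ≤ 2 * κ * ‖x‖` for this difference `x`, and `2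
  -- * κ ≤ 1 / 2`.
  have h0 : ‖w' 0 - w 0‖ = 0 := by
    have := norm_nonneg (w' 0 - w 0)
    nlinarith
  intro s hs
  have h2 := hdiff q u' w' u w h' h s hs
  rw [norm_eq_zero.1 h0, smul_zero, sub_zero, norm_zero, mul_zero] at h2
  exact sub_eq_zero.1 (norm_le_zero_iff.1 h2)

end NullRay

/-! ### Existence of null rays. -/

section NullRayExistence

set_option maxSynthPendingDepth 3

variable {E : Type*} [NormedAddCommGroup E] [NormedSpace ℝ E]

/-- A map that differs from the identity by a Lipschitz map with small constant covers balls. -/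
theorem exists_eq_of_approx_id [CompleteSpace E] {Φ : E → E} {δ : ℝ} (hδ : 0 ≤ δ)
    (hΦ : ∀ v ∈ Metric.closedBall (0 : E) δ, ∀ v' ∈ Metric.closedBall (0 : E) δ,
      ‖Φ v - Φ v' - (v - v')‖ ≤ 1 / 2 * ‖v - v'‖)
    {x : E} (hx : ‖x - Φ 0‖ ≤ δ / 2) : ∃ v ∈ Metric.closedBall (0 : E) δ, Φ v = x := by
  -- The identity is its own right inverse with constant 1, so the ball of radius `(1 - 1 / 2) * δ`
  -- around `Φ 0` is covered.
  let inv : (ContinuousLinearMap.id ℝ E).NonlinearRightInverse :=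
    { toFun := id
      nnnorm := 1
      bound' := fun y ↦ by simp
      right_inv' := fun y ↦ rfl }
  have happ : ApproximatesLinearOn Φ (ContinuousLinearMap.id ℝ E) (Metric.closedBall 0 δ) (1 / 2) :=
    fun v hv v' hv' ↦ by simpa using hΦ v hv v' hv'
  have hsurj := happ.surjOn_closedBall_of_nonlinearRightInverse inv hδ (b := 0) subset_rfl
  refine hsurj ?_
  rw [mem_closedBall_iff_norm]
  refine hx.trans ?_
  simp only [inv, inv_one, NNReal.coe_one, NNReal.coe_div, NNReal.coe_ofNat]
  linarith

variable {G : E → E →L[ℝ] E →L[ℝ] ℝ} {x₀ T : E} {β : ℝ → E} {t₀ : ℝ} {S : Set E}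

/-- A short geodesic that starts lightlike in the time cone of `T` remains so. -/
theorem IsSpraySolution.isNullRay {V : Set E} {q : E} {u w : ℝ → E}
    (h : IsSpraySolution (geodesicSpray G) u w) (hd : ∀ y ∈ V, DifferentiableAt ℝ G y)
    (hL : ∀ y ∈ V, IsLorentzForm (G y)) (hT : ∀ y ∈ V, G y T T < 0)
    (hinv : ∀ y ∈ V, (G y).IsInvertible) (hV : ∀ s ∈ Set.Icc (0 : ℝ) 1, u s ∈ V)
    (hw : ∀ s ∈ Set.Icc (0 : ℝ) 1, w s ≠ 0) (hq : u 0 = q) (hS : u 1 ∈ S)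
    (hnull : G q (w 0) (w 0) = 0) (hfut : G q T (w 0) < 0) : IsNullRay G T V S q u w := by
  have hacc : ∀ s ∈ Set.Icc (0 : ℝ) 1, ∀ x, G (u s) (geodesicSpray G (u s) (w s) (w s)) x
      + metricChristoffel G (u s) (w s) (w s) x = 0 := fun s hs ↦
    (geodesicSpray_eq_iff (hinv _ (hV s hs)) _ _).2 rfl
  have hmem0 : (0 : ℝ) ∈ Set.Icc (0 : ℝ) 1 := by simp
  have hnull' : ∀ s ∈ Set.Icc (0 : ℝ) 1, G (u s) (w s) (w s) = 0 := by
    intro s hs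
    have := (convex_Icc (0 : ℝ) 1).norm_image_sub_le_of_norm_hasDerivWithin_le (C := 0)
      (fun s hs ↦ hasDerivWithinAt_speed (hd _ (hV s hs)) (hL _ (hV s hs)).symm (h.pos s hs)
        (h.vel s hs) (hacc s hs)) (fun s hs ↦ by simp) hmem0 hs
    rw [zero_mul, norm_le_zero_iff, sub_eq_zero, hq, hnull] at this
    exact this
  have hcont : ContinuousOn (fun s ↦ G (u s) T (w s)) (Set.Icc 0 1) := fun s hs ↦
    (((hd _ (hV s hs)).continuousAt.comp_continuousWithinAt
      (h.pos s hs).continuousWithinAt).clm_apply continuousWithinAt_const).clm_apply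
      (h.vel s hs).continuousWithinAt
  refine ⟨h.pos, fun s hs ↦ ⟨_, h.vel s hs, hacc s hs⟩, hnull', fun s hs ↦ ?_, hq, hS, hV⟩
  -- Leaving the cone would require `G (u s) T (w s)` to vanish somewhere, but a null vector
  -- orthogonal to a timelike one is zero.
  by_contra hneg
  have hsub : Set.Icc 0 s ⊆ Set.Icc (0 : ℝ) 1 := Set.Icc_subset_Icc_right hs.2
  obtain ⟨m, hm, hm0⟩ := intermediate_value_Icc hs.1 (hcont.mono hsub)
    (show (0 : ℝ) ∈ Set.Icc (G (u 0) T (w 0)) (G (u s) T (w s)) from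
      ⟨by rw [hq]; exact hfut.le, not_lt.1 hneg⟩)
  exact hw m (hsub hm) ((hL _ (hV m (hsub hm))).eq_zero_of_causal (hT _ (hV m (hsub hm)))
    (hnull' m (hsub hm)).le hm0)

/-- Every point near `x₀` off a timelike curve is joined to it by a null ray in a small ball. -/
theorem eventually_exists_nullRay [FiniteDimensional ℝ E] (hG : ContDiffAt ℝ 2 G x₀)
    (hL : ∀ᶠ y in 𝓝 x₀, IsLorentzForm (G y)) (hT : G x₀ T T < 0) (hβ : HasStrictDerivAt β T t₀)
    (hβ0 : β t₀ = x₀) (hS : ∀ᶠ t in 𝓝 t₀, β t ∈ S) {r : ℝ} (hr : 0 < r) :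
    ∀ᶠ q in 𝓝 x₀, q ∉ S → ∃ u w, IsNullRay G T (Metric.ball x₀ r) S q u w := by
  have := FiniteDimensional.complete ℝ E
  have hGc := hG.continuousAt
  obtain ⟨ε, hε, hN₁⟩ := exists_eventually_timelike hGc hT
  obtain ⟨κ, hκ, hκ4, c, hc, hcone⟩ := exists_eq_smul_near T hε
  have hi : (G x₀).IsInvertible := isInvertible_of_injective (hL.self_of_nhds.injective hT)
  have hA := contDiffAt_geodesicSpray hG hi
  obtain ⟨ρ, hρ, hlip⟩ := exists_spray_lipschitz hA hκ
  have hdiff : ∀ᶠ y in 𝓝 x₀, DifferentiableAt ℝ G y :=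
    (hG.eventually (by simp)).mono fun y hy ↦ hy.differentiableAt (by norm_num)
  obtain ⟨R, hR, hN⟩ := Metric.eventually_nhds_iff_ball.1 (hN₁.and (hL.and hdiff))
  set r' := min (min r ρ) R with hr'
  have hr'0 : 0 < r' := by positivity
  have hr'r : Metric.ball x₀ r' ⊆ Metric.ball x₀ r :=
    Metric.ball_subset_ball ((min_le_left _ _).trans (min_le_left _ _))
  have hr'ρ : ∀ x : E, Metric.ball x r' ⊆ Metric.ball x ρ := fun x ↦
    Metric.ball_subset_ball ((min_le_left _ _).trans (min_le_right _ _))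
  have hr'R : Metric.ball x₀ r' ⊆ Metric.ball x₀ R := Metric.ball_subset_ball (min_le_right _ _)
  obtain ⟨δ, hδ, hsol⟩ := exists_isSpraySolution hA hr'0
  obtain ⟨η, hη, hβη⟩ := hβ.exists_norm_sub_sub_le (half_pos hc)
  have hβc : ∀ᶠ t in 𝓝 t₀, β t ∈ Metric.ball x₀ (δ / 8) :=
    hβ.hasDerivAt.continuousAt.eventually (by
      rw [hβ0]
      exact Metric.ball_mem_nhds _ (by positivity))
  obtain ⟨η', hη', hβS⟩ := Metric.eventually_nhds_iff.1 (hS.and hβc)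
  set h := min η η' / 2 with hh
  have hh0 : 0 < h := by positivity
  have hhη : h < η := by
    have := min_le_left η η'
    have : 0 < min η η' := by positivity
    linarith
  have hhη' : h < η' := by
    have := min_le_right η η'
    have : 0 < min η η' := by positivity
    linarith
  set J := Set.Icc (t₀ - h) (t₀ + h) with hJ
  have hJabs : ∀ t ∈ J, |t - t₀| ≤ h := fun t ht ↦ abs_le.2 ⟨by linarith [ht.1], by linarith [ht.2]⟩
  have hJS : ∀ t ∈ J, β t ∈ S ∧ ‖β t - x₀‖ < δ / 8 := by
    intro t ht
    have := hβS (show dist t t₀ < η' from (hJabs t ht).trans_lt hhη')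
    rwa [mem_ball_iff_norm] at this
  -- `δ / 8` here and for `β t` gives `‖β t - q‖ < δ / 4`, half the radius `δ / 2` on which exp_q is
  -- inverted. `c / 2 * h` shares the tolerance `c * h` of `hcone` with the chord estimate. `r'`
  -- keeps `q` itself in the small ball.
  filter_upwards [Metric.ball_mem_nhds x₀ (show 0 < min (min (δ / 8) (c / 2 * h)) r' by positivity)]
    with q hq hqS
  rw [mem_ball_iff_norm, lt_min_iff, lt_min_iff] at hq
  obtain ⟨⟨hqδ, hqc⟩, hqr'⟩ := hq
  rw [← mem_ball_iff_norm] at hqr'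
  have hqδ' : q ∈ Metric.ball x₀ δ := by
    rw [mem_ball_iff_norm]
    linarith
  choose! u w hsol huq hwv hball using hsol q hqδ'
  have hcl : ∀ v ∈ Metric.closedBall (0 : E) (δ / 2), v ∈ Metric.ball (0 : E) δ := fun v hv ↦
    Metric.closedBall_subset_ball (half_lt_self hδ) hv
  have hest : ∀ v ∈ Metric.closedBall (0 : E) (δ / 2), ∀ v' ∈ Metric.closedBall (0 : E) (δ / 2),
      ‖u v 1 - u v' 1 - (v - v')‖ ≤ 2 * κ * ‖v - v'‖ := by
    intro v hv v' hv'
    have hv := hcl v hv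
    have hv' := hcl v' hv'
    have := (IsSpraySolution.norm_sub_sub_le (by linarith) hlip hκ (hsol v hv) (hsol v' hv')
      (fun s hs ↦ hr'ρ _ (hball v hv s hs).1) (fun s hs ↦ hr'ρ _ (hball v hv s hs).2)
      (fun s hs ↦ hr'ρ _ (hball v' hv' s hs).1) (fun s hs ↦ hr'ρ _ (hball v' hv' s hs).2)
      ((huq v hv).trans (huq v' hv').symm) 1 (by simp)).2
    rwa [one_smul, hwv v hv, hwv v' hv'] at this
  have hest0 : ∀ v ∈ Metric.closedBall (0 : E) (δ / 2), ∀ s ∈ Set.Icc (0 : ℝ) 1,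
      ‖w v s - v‖ ≤ 2 * κ * ‖v‖ ∧ ‖u v s - q - s • v‖ ≤ 2 * κ * ‖v‖ := by
    intro v hv s hs
    have hv := hcl v hv
    have := IsSpraySolution.norm_sub_sub_le (by linarith) hlip hκ (hsol v hv)
      (isSpraySolution_const _ q)
      (fun s hs ↦ hr'ρ _ (hball v hv s hs).1) (fun s hs ↦ hr'ρ _ (hball v hv s hs).2)
      (fun s _ ↦ hr'ρ _ hqr') (fun s _ ↦ Metric.mem_ball_self hρ) (huq v hv) s hs
    simpa [hwv v hv] using this
  have hκ2 : ∀ x : ℝ, 0 ≤ x → 2 * κ * x ≤ 1 / 2 * x := fun x hx ↦ by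
    gcongr
    linarith
  have h0mem : (0 : E) ∈ Metric.closedBall (0 : E) (δ / 2) :=
    Metric.mem_closedBall_self (half_pos hδ).le
  have hu0 : u 0 1 = q := by
    have := (hest0 0 h0mem 1 (by simp)).2
    simpa [sub_eq_zero] using this
  -- Here `fun v ↦ u v 1` plays the role of exp_q, and `v t` becomes the preimage of `β t`.
  have hex : ∀ t ∈ J, ∃ v ∈ Metric.closedBall (0 : E) (δ / 2), u v 1 = β t := by
    intro t ht
    refine exists_eq_of_approx_id (Φ := fun v ↦ u v 1) (by positivity)
      (fun v hv v' hv' ↦ (hest v hv v' hv').trans (hκ2 _ (norm_nonneg _))) ?_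
    rw [hu0]
    have h1 := norm_sub_le_norm_sub_add_norm_sub (β t) x₀ q
    rw [norm_sub_rev x₀ q] at h1
    linarith [(hJS t ht).2]
  choose! v hv hvβ using hex
  have hβJ : ContinuousOn β J := by
    intro t ht
    have hb : ∀ t' ∈ J, ‖β t' - β t‖ ≤ (‖T‖ + c / 2) * |t' - t| := by
      intro t' ht'
      have h1 := hβη t t' ((hJabs t ht).trans_lt hhη) ((hJabs t' ht').trans_lt hhη)
      have h2 := norm_le_norm_add_norm_sub ((t' - t) • T) (β t' - β t)
      rw [norm_smul, Real.norm_eq_abs] at h2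
      have h3 : ‖(t' - t) • T - (β t' - β t)‖ = ‖β t' - β t - (t' - t) • T‖ := norm_sub_rev _ _
      linarith
    rw [ContinuousWithinAt, tendsto_iff_norm_sub_tendsto_zero]
    refine squeeze_zero' (Filter.Eventually.of_forall fun _ ↦ norm_nonneg _)
      (Filter.eventually_of_mem self_mem_nhdsWithin hb) ?_
    have : Continuous (fun t' ↦ (‖T‖ + c / 2) * |t' - t|) := by fun_prop
    have := this.tendsto t
    simp only [sub_self, abs_zero, mul_zero] at this
    exact this.mono_left nhdsWithin_le_nhds
  have hvJ : ContinuousOn v J := by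
    intro t ht
    have hb : ∀ t' ∈ J, ‖v t' - v t‖ ≤ 2 * ‖β t' - β t‖ := by
      intro t' ht'
      have h1 := (hest _ (hv t' ht') _ (hv t ht)).trans (hκ2 _ (norm_nonneg _))
      rw [hvβ t' ht', hvβ t ht] at h1
      have h2 := norm_le_norm_add_norm_sub (β t' - β t) (v t' - v t)
      linarith
    rw [ContinuousWithinAt, tendsto_iff_norm_sub_tendsto_zero]
    refine squeeze_zero' (Filter.Eventually.of_forall fun _ ↦ norm_nonneg _)
      (Filter.eventually_of_mem self_mem_nhdsWithin hb) ?_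
    have := (tendsto_iff_norm_sub_tendsto_zero.1 (hβJ t ht)).const_mul 2
    simpa using this
  have hqR := hN q (hr'R hqr')
  have hTq : G q T T < 0 := (hqR.1 T (by simpa using hε)).1
  have ht₀η : |t₀ - t₀| < η := by simpa using hη
  have haJ : t₀ - h ∈ J := ⟨le_rfl, by linarith⟩
  have hbJ : t₀ + h ∈ J := ⟨by linarith, le_rfl⟩
  have hend : ∀ t ∈ J, ‖β t - q - v t‖ ≤ 2 * κ * ‖v t‖ := by
    intro t ht
    have := (hest0 _ (hv t ht) 1 (by simp)).2
    rwa [one_smul, hvβ t ht] at this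
  have hb : G q (v (t₀ + h)) (v (t₀ + h)) < 0 ∧ G q T (v (t₀ + h)) < 0 := by
    have h1 := hβη t₀ (t₀ + h) ht₀η ((hJabs _ hbJ).trans_lt hhη)
    rw [add_sub_cancel_left, abs_of_pos hh0, hβ0] at h1
    have h2 : ‖β (t₀ + h) - q - h • T‖ ≤ c * h := by
      have h3 : β (t₀ + h) - q - h • T = (β (t₀ + h) - x₀ - h • T) - (q - x₀) := by abel
      rw [h3]
      refine (norm_sub_le _ _).trans ?_
      linarith
    obtain ⟨e, he, hve⟩ := hcone h hh0 _ _ h2 (hend _ hbJ)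
    have h3 := hqR.1 e he
    rw [hve]
    simp only [map_smul, smul_apply, smul_eq_mul]
    exact ⟨mul_neg_of_pos_of_neg hh0 (mul_neg_of_pos_of_neg hh0 h3.1),
      mul_neg_of_pos_of_neg hh0 h3.2⟩
  have ha : 0 < G q T (v (t₀ - h)) := by
    have h1 := hβη (t₀ - h) t₀ ((hJabs _ haJ).trans_lt hhη) ht₀η
    rw [sub_sub_cancel, abs_of_pos hh0, hβ0] at h1
    have h2 : ‖q - β (t₀ - h) - h • T‖ ≤ c * h := by
      have h3 : q - β (t₀ - h) - h • T = (x₀ - β (t₀ - h) - h • T) + (q - x₀) := by abel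
      rw [h3]
      refine (norm_add_le _ _).trans ?_
      linarith
    have h4 : ‖q - β (t₀ - h) - -v (t₀ - h)‖ ≤ 2 * κ * ‖-v (t₀ - h)‖ := by
      have h5 := hend _ haJ
      rw [norm_neg]
      rwa [← norm_neg, show -(β (t₀ - h) - q - v (t₀ - h)) = q - β (t₀ - h) - -v (t₀ - h) by abel]
        at h5
    obtain ⟨e, he, hve⟩ := hcone h hh0 _ _ h2 h4
    have h3 := hqR.1 e he
    rw [← neg_neg (v (t₀ - h)), hve]
    simp only [map_neg, map_smul, smul_eq_mul]
    have := mul_neg_of_pos_of_neg hh0 h3.2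
    linarith
  -- This maximum is negative exactly on timelike vectors in the cone of `T`. It is negative at `t₀
  -- + h` and positive at `t₀ - h`; at a zero the vector is causal with `G q T (v t) ≤ 0`, and being
  -- nonzero it must be null.
  have hcont : ContinuousOn (fun t ↦ max (G q (v t) (v t)) (G q T (v t))) J := by
    have h1 : Continuous (fun x ↦ max (G q x x) (G q T x)) := by fun_prop
    exact h1.comp_continuousOn hvJ
  obtain ⟨t, ht, htz⟩ := intermediate_value_Icc' (show t₀ - h ≤ t₀ + h by linarith) hcont
    (show (0 : ℝ) ∈ Set.Icc _ _ from ⟨(max_lt hb.1 hb.2).le, ha.le.trans (le_max_right _ _)⟩)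
  have htz : max (G q (v t) (v t)) (G q T (v t)) = 0 := htz
  have hle1 : G q (v t) (v t) ≤ 0 := (le_max_left _ _).trans htz.le
  have hle2 : G q T (v t) ≤ 0 := (le_max_right _ _).trans htz.le
  have hvt0 : v t ≠ 0 := by
    intro h0
    apply hqS
    rw [← hu0, ← h0, hvβ t ht]
    exact (hJS t ht).1
  have hfut : G q T (v t) < 0 := lt_of_le_of_ne hle2 fun h0 ↦
    hvt0 (hqR.2.1.eq_zero_of_causal hTq hle1 h0)
  have hnull : G q (v t) (v t) = 0 := by
    rcases max_choice (G q (v t) (v t)) (G q T (v t)) with h1 | h1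
    · rwa [h1] at htz
    · exact absurd (h1 ▸ htz) hfut.ne
  have hvt := hcl _ (hv t ht)
  have hTR : ∀ y ∈ Metric.ball x₀ r', G y T T < 0 := fun y hy ↦
    ((hN y (hr'R hy)).1 T (by simpa using hε)).1
  refine ⟨u (v t), w (v t), IsNullRay.mono (V := Metric.ball x₀ r') ?_ hr'r⟩
  refine (hsol _ hvt).isNullRay (fun y hy ↦ (hN y (hr'R hy)).2.2) (fun y hy ↦ (hN y (hr'R hy)).2.1)
    hTR (fun y hy ↦ isInvertible_of_injective ((hN y (hr'R hy)).2.1.injective (hTR y hy)))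
    (fun s hs ↦ (hball _ hvt s hs).1) (fun s hs h0 ↦ ?_) (huq _ hvt) ?_ ?_ ?_
  · have h1 := ((hest0 _ (hv t ht) s hs).1).trans (hκ2 _ (norm_nonneg _))
    rw [h0, zero_sub, norm_neg] at h1
    have : 0 < ‖v t‖ := norm_pos_iff.2 hvt0
    linarith
  · rw [hvβ t ht]
    exact (hJS t ht).1
  · rw [hwv _ hvt, hnull]
  · rw [hwv _ hvt]
    exact hfut

end NullRayExistence

/-! ### Coordinate invariance of the geodesic equation. -/

section CoordinateChange

set_option maxSynthPendingDepth 3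

variable {E : Type*} [NormedAddCommGroup E] [NormedSpace ℝ E]

theorem fderiv_bilin_apply {G : E → E →L[ℝ] E →L[ℝ] ℝ} {y : E} (hG : DifferentiableAt ℝ G y)
    (a b w : E) : fderiv ℝ (fun z ↦ G z b w) y a = fderiv ℝ G y a b w := by
  have h := (hG.hasFDerivAt.clm_apply (hasFDerivAt_const b y)).clm_apply (hasFDerivAt_const w y)
  rw [h.fderiv]
  simp

/-- The derivative of the coefficients of a metric that is a pullback. -/
theorem fderiv_pullback_metric {G G' : E → E →L[ℝ] E →L[ℝ] ℝ} {ψ : E → E} {y : E}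
    (hG : DifferentiableAt ℝ G y) (hG' : DifferentiableAt ℝ G' (ψ y)) (hψ : ContDiffAt ℝ 2 ψ y)
    (h : ∀ᶠ z in 𝓝 y, ∀ v w, G z v w = G' (ψ z) (fderiv ℝ ψ z v) (fderiv ℝ ψ z w)) (a b w : E) :
    fderiv ℝ G y a b w =
      fderiv ℝ G' (ψ y) (fderiv ℝ ψ y a) (fderiv ℝ ψ y b) (fderiv ℝ ψ y w)
      + G' (ψ y) (fderiv ℝ (fderiv ℝ ψ) y a b) (fderiv ℝ ψ y w)
      + G' (ψ y) (fderiv ℝ ψ y b) (fderiv ℝ (fderiv ℝ ψ) y a w) := by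
  have hψ1 : HasFDerivAt ψ (fderiv ℝ ψ y) y := (hψ.differentiableAt (by norm_num)).hasFDerivAt
  have hψ2 : HasFDerivAt (fderiv ℝ ψ) (fderiv ℝ (fderiv ℝ ψ) y) y :=
    ((hψ.fderiv_right (m := 1) (by norm_num)).differentiableAt (by norm_num)).hasFDerivAt
  have h1 : HasFDerivAt (fun z ↦ G' (ψ z)) (fderiv ℝ G' (ψ y) ∘L fderiv ℝ ψ y) y :=
    hG'.hasFDerivAt.comp y hψ1
  have h2 := hψ2.clm_apply (hasFDerivAt_const b y)
  have h3 := hψ2.clm_apply (hasFDerivAt_const w y)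
  have h4 := (h1.clm_apply h2).clm_apply h3
  have h5 : (fun z ↦ G z b w) =ᶠ[𝓝 y]
      fun z ↦ G' (ψ z) (fderiv ℝ ψ z b) (fderiv ℝ ψ z w) := h.mono fun z hz ↦ hz b w
  rw [← fderiv_bilin_apply hG, h5.fderiv_eq, h4.fderiv]
  simp
  ring

/-- The geodesic equation is invariant under changes of coordinates. -/
theorem geodesic_equation_transform {G G' : E → E →L[ℝ] E →L[ℝ] ℝ} {ψ : E → E} {y : E}
    (hG : DifferentiableAt ℝ G y) (hG' : DifferentiableAt ℝ G' (ψ y)) (hψ : ContDiffAt ℝ 2 ψ y)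
    (hsymm : ∀ v w, G' (ψ y) v w = G' (ψ y) w v)
    (h : ∀ᶠ z in 𝓝 y, ∀ v w, G z v w = G' (ψ z) (fderiv ℝ ψ z v) (fderiv ℝ ψ z w)) (a b x : E) :
    G y b x + metricChristoffel G y a a x =
    G' (ψ y) (fderiv ℝ (fderiv ℝ ψ) y a a + fderiv ℝ ψ y b) (fderiv ℝ ψ y x)
      + metricChristoffel G' (ψ y) (fderiv ℝ ψ y a) (fderiv ℝ ψ y a) (fderiv ℝ ψ y x) := by
  -- By this symmetry the terms containing D²ψ(a, x) cancel in the Christoffel combination, leaving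
  -- only the one with D²ψ(a, a).
  have hs : fderiv ℝ (fderiv ℝ ψ) y x a = fderiv ℝ (fderiv ℝ ψ) y a x :=
    (hψ.isSymmSndFDerivAt (by simp)).eq x a
  simp only [metricChristoffel, fderiv_pullback_metric hG hG' hψ h, h.self_of_nhds b x, hs,
    map_add, add_apply, hsymm (fderiv ℝ (fderiv ℝ ψ) y a x)]
  ring

/-- First and second derivative of a curve in new coordinates. -/
theorem derivWithin_comp_curve {ψ : E → E} {u w v : ℝ → E} {a : E} {J : Set ℝ} {s : ℝ} (hs : s ∈ J)
    (hJ : UniqueDiffOn ℝ J) (hu : ∀ r ∈ J, HasDerivWithinAt u (w r) J r)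
    (hw : HasDerivWithinAt w a J s) (hψ : ContDiffAt ℝ 2 ψ (u s))
    (hv : ∀ᶠ r in 𝓝[J] s, v r = ψ (u r)) :
    derivWithin v J s = fderiv ℝ ψ (u s) (w s) ∧
    derivWithin (derivWithin v J) J s =
      fderiv ℝ (fderiv ℝ ψ) (u s) (w s) (w s) + fderiv ℝ ψ (u s) a := by
  have hψu : ∀ᶠ r in 𝓝[J] s, ContDiffAt ℝ 2 ψ (u r) :=
    (hu s hs).continuousWithinAt.eventually (hψ.eventually (by simp))
  have hd : ∀ᶠ r in 𝓝[J] s, derivWithin v J r = fderiv ℝ ψ (u r) (w r) := by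
    filter_upwards [eventually_eventually_nhdsWithin.2 hv, hψu, self_mem_nhdsWithin]
      with r hr hψr hrJ
    have h1 : HasDerivWithinAt (fun r ↦ ψ (u r)) (fderiv ℝ ψ (u r) (w r)) J r :=
      (hψr.differentiableAt (by norm_num)).hasFDerivAt.comp_hasDerivWithinAt r (hu r hrJ)
    exact (h1.congr_of_eventuallyEq hr (hr.self_of_nhdsWithin hrJ)).derivWithin (hJ r hrJ)
  refine ⟨hd.self_of_nhdsWithin hs, ?_⟩
  have h2 : HasFDerivAt (fderiv ℝ ψ) (fderiv ℝ (fderiv ℝ ψ) (u s)) (u s) :=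
    ((hψ.fderiv_right (m := 1) (by norm_num)).differentiableAt (by norm_num)).hasFDerivAt
  have h3 : HasDerivWithinAt (fun r ↦ fderiv ℝ ψ (u r)) (fderiv ℝ (fderiv ℝ ψ) (u s) (w s)) J s :=
    h2.comp_hasDerivWithinAt s (hu s hs)
  have h4 := h3.clm_apply hw
  exact (h4.congr_of_eventuallyEq hd (hd.self_of_nhdsWithin hs)).derivWithin (hJ s hs)

end CoordinateChange

/-! ### The metric coefficients in a chart. -/

section ChartMetric

set_option maxSynthPendingDepth 3

variable {M : Type*} [TopologicalSpace M] [ChartedSpace (EuclideanSpace ℝ (Fin 4)) M]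
  [IsManifold (𝓡 4) ∞ M]

local notation "𝔼" => EuclideanSpace ℝ (Fin 4)

/-- The derivative of the inverse of the chart around `x₀`, as an endomorphism of the model. -/
noncomputable def chartSymmDeriv (x₀ : M) (y : EuclideanSpace ℝ (Fin 4)) : 𝔼 →L[ℝ] 𝔼 :=
  mfderiv 𝓘(ℝ, 𝔼) (𝓡 4) (extChartAt (𝓡 4) x₀).symm y

/-- The metric at `x`, as a bilinear form on the model space. -/
def LorentzMetric.form (g : LorentzMetric M) (x : M) : 𝔼 →L[ℝ] 𝔼 →L[ℝ] ℝ := g.val x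

/-- The metric coefficients in the chart around `x₀`. -/
noncomputable def LorentzMetric.chartMetric (g : LorentzMetric M) (x₀ : M) (y : 𝔼) :
    𝔼 →L[ℝ] 𝔼 →L[ℝ] ℝ :=
  (g.form ((extChartAt (𝓡 4) x₀).symm y)).bilinearComp (chartSymmDeriv x₀ y) (chartSymmDeriv x₀ y)

theorem LorentzMetric.chartMetric_apply (g : LorentzMetric M) (x₀ : M) (y v w : 𝔼) :
    g.chartMetric x₀ y v w = g.inChart x₀ y v w := rfl

/-- The coordinate vector field of the chart around `x₀` in the direction `a`. -/
noncomputable def coordField (x₀ : M) (a : 𝔼) (x : M) : TangentSpace (𝓡 4) x :=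
  (trivializationAt 𝔼 (TangentSpace (𝓡 4)) x₀).symmL ℝ x a

/-- In the trivialization at `x₀` the field is the constant `a`. -/
theorem contMDiffAt_coordField {x₀ x : M} (hx : x ∈ (extChartAt (𝓡 4) x₀).source) (a : 𝔼) :
    ContMDiffAt (𝓡 4) ((𝓡 4).prod 𝓘(ℝ, 𝔼)) ∞
      (fun x ↦ TotalSpace.mk' 𝔼 (E := TangentSpace (𝓡 4)) x (coordField x₀ a x)) x := by
  have hb : ∀ x, x ∈ (extChartAt (𝓡 4) x₀).source →
      x ∈ (trivializationAt 𝔼 (TangentSpace (𝓡 4)) x₀).baseSet := by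
    intro x hx
    simpa using hx
  rw [(trivializationAt 𝔼 (TangentSpace (𝓡 4)) x₀).contMDiffAt_section_iff (hb x hx)]
  refine (contMDiffAt_const (c := a)).congr_of_eventuallyEq ?_
  filter_upwards [(isOpen_extChartAt_source x₀).mem_nhds hx] with z hz
  have h := (trivializationAt 𝔼 (TangentSpace (𝓡 4)) x₀).continuousLinearMapAt_symmL (R := ℝ)
    (hb z hz) a
  rw [← Trivialization.continuousLinearMapAt_apply_of_mem ℝ (hb := hb z hz)]
  exact h

theorem LorentzMetric.contMDiffAt_apply_coordField (g : LorentzMetric M) {x₀ x : M}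
    (hx : x ∈ (extChartAt (𝓡 4) x₀).source) (a b : 𝔼) :
    ContMDiffAt (𝓡 4) 𝓘(ℝ, ℝ) ∞ (fun x ↦ g.val x (coordField x₀ a x) (coordField x₀ b x)) x := by
  have h : ContMDiffAt (𝓡 4) ((𝓡 4).prod 𝓘(ℝ, ℝ)) ∞ (fun x ↦ TotalSpace.mk' ℝ (E := Bundle.Trivial M ℝ) x
      (g.val x (coordField x₀ a x) (coordField x₀ b x))) x :=
    ContMDiffAt.clm_bundle_apply₂ (F₁ := 𝔼) (F₂ := 𝔼) (g.smooth x) (contMDiffAt_coordField hx a)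
      (contMDiffAt_coordField hx b)
  simp only [Bundle.contMDiffAt_totalSpace] at h
  exact h.2

theorem hasMFDerivAt_extChartAt_symm (x₀ : M) {y : 𝔼} (hy : y ∈ (extChartAt (𝓡 4) x₀).target) :
    HasMFDerivAt 𝓘(ℝ, 𝔼) (𝓡 4) (extChartAt (𝓡 4) x₀).symm y (chartSymmDeriv x₀ y) := by
  have h : MDifferentiableAt 𝓘(ℝ, 𝔼) (𝓡 4) (extChartAt (𝓡 4) x₀).symm y :=
    (((contMDiffOn_extChartAt_symm (n := ∞) x₀) y hy).contMDiffAt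
      ((isOpen_extChartAt_target x₀).mem_nhds hy)).mdifferentiableAt (by simp)
  exact h.hasMFDerivAt

/-- The derivative of the chart around `x₀`, as an endomorphism of the model. -/
noncomputable def chartDeriv (x₀ x : M) : 𝔼 →L[ℝ] 𝔼 :=
  mfderiv (𝓡 4) 𝓘(ℝ, 𝔼) (extChartAt (𝓡 4) x₀) x

theorem chartSymmDeriv_chartDeriv {x₀ x : M} (hx : x ∈ (extChartAt (𝓡 4) x₀).source) (v : 𝔼) :
    chartSymmDeriv x₀ (extChartAt (𝓡 4) x₀ x) (chartDeriv x₀ x v) = v := by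
  have h := mfderivWithin_extChartAt_symm_comp_mfderiv_extChartAt' hx
  simp only [modelWithCornersSelf_coe, Set.range_id, mfderivWithin_univ] at h
  exact DFunLike.congr_fun h v

theorem chartDeriv_chartSymmDeriv {x₀ x : M} (hx : x ∈ (extChartAt (𝓡 4) x₀).source) (v : 𝔼) :
    chartDeriv x₀ x (chartSymmDeriv x₀ (extChartAt (𝓡 4) x₀ x) v) = v := by
  have h := mfderiv_extChartAt_comp_mfderivWithin_extChartAt_symm' hx
  simp only [modelWithCornersSelf_coe, Set.range_id, mfderivWithin_univ] at h
  exact DFunLike.congr_fun h v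

theorem injective_chartSymmDeriv (x₀ : M) {y : 𝔼} (hy : y ∈ (extChartAt (𝓡 4) x₀).target) :
    Function.Injective (chartSymmDeriv x₀ y) := by
  have h := chartDeriv_chartSymmDeriv ((extChartAt (𝓡 4) x₀).map_target hy)
  rw [(extChartAt (𝓡 4) x₀).right_inv hy] at h
  exact Function.LeftInverse.injective h

/-- The bridge between the bundle trivialization, in which smoothness of the metric is given, and
the chart derivative, in which its coefficients are defined. -/
theorem coordField_eq {x₀ x : M} (hx : x ∈ (extChartAt (𝓡 4) x₀).source) (a : 𝔼) :
    coordField x₀ a x = chartSymmDeriv x₀ (extChartAt (𝓡 4) x₀ x) a := by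
  have h := TangentBundle.symmL_trivializationAt (𝕜 := ℝ) (I := 𝓡 4) (x₀ := x₀) (x := x)
    (by simpa using hx)
  simp only [modelWithCornersSelf_coe, Set.range_id, mfderivWithin_univ] at h
  exact DFunLike.congr_fun h a

theorem LorentzMetric.contDiffOn_chartMetric (g : LorentzMetric M) (x₀ : M) :
    ContDiffOn ℝ ∞ (g.chartMetric x₀) (extChartAt (𝓡 4) x₀).target := by
  rw [contDiffOn_clm_apply]
  intro a
  rw [contDiffOn_clm_apply]
  intro b
  rw [← contMDiffOn_iff_contDiffOn]
  have h : ContMDiffOn (𝓡 4) 𝓘(ℝ, ℝ) ∞ (fun x ↦ g.val x (coordField x₀ a x) (coordField x₀ b x))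
      (extChartAt (𝓡 4) x₀).source := fun x hx ↦
    (g.contMDiffAt_apply_coordField hx a b).contMDiffWithinAt
  refine (h.comp (contMDiffOn_extChartAt_symm x₀) (extChartAt (𝓡 4) x₀).mapsTo_symm).congr ?_
  intro y hy
  have hx := (extChartAt (𝓡 4) x₀).map_target hy
  simp only [Function.comp_apply]
  rw [coordField_eq hx, coordField_eq hx, (extChartAt (𝓡 4) x₀).right_inv hy]
  rfl

theorem LorentzMetric.contDiffAt_chartMetric (g : LorentzMetric M) (x₀ : M) {y : 𝔼}
    (hy : y ∈ (extChartAt (𝓡 4) x₀).target) : ContDiffAt ℝ 2 (g.chartMetric x₀) y :=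
  ((g.contDiffOn_chartMetric x₀).contDiffAt ((isOpen_extChartAt_target x₀).mem_nhds hy)).of_le
    ENat.LEInfty.out

theorem LorentzMetric.christoffel_eq (g : LorentzMetric M) (x₀ : M) {y : 𝔼}
    (hy : y ∈ (extChartAt (𝓡 4) x₀).target) (a b w : 𝔼) :
    g.christoffel x₀ y a b w = metricChristoffel (g.chartMetric x₀) y a b w := by
  have hd : DifferentiableAt ℝ (g.chartMetric x₀) y :=
    (g.contDiffAt_chartMetric x₀ hy).differentiableAt (by norm_num)
  simp only [LorentzMetric.christoffel, metricChristoffel, ← fderiv_bilin_apply hd,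
    LorentzMetric.chartMetric_apply]

/-- Vectors orthogonal to a timelike vector of Minkowski space are spacelike. -/
theorem minkowski_pos_of_orthogonal {t₀ t₁ t₂ t₃ v₀ v₁ v₂ v₃ : ℝ}
    (ht : -(t₀ * t₀) + t₁ * t₁ + t₂ * t₂ + t₃ * t₃ < 0)
    (htv : -(t₀ * v₀) + t₁ * v₁ + t₂ * v₂ + t₃ * v₃ = 0)
    (hv : ¬ (v₀ = 0 ∧ v₁ = 0 ∧ v₂ = 0 ∧ v₃ = 0)) :
    0 < -(v₀ * v₀) + v₁ * v₁ + v₂ * v₂ + v₃ * v₃ := by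
  have ht0 : 0 < t₀ ^ 2 := by nlinarith [sq_nonneg t₁, sq_nonneg t₂, sq_nonneg t₃]
  have hn : 0 < v₁ ^ 2 + v₂ ^ 2 + v₃ ^ 2 := by
    by_contra hcon
    have h1 : v₁ = 0 := by nlinarith [sq_nonneg v₁, sq_nonneg v₂, sq_nonneg v₃]
    have h2 : v₂ = 0 := by nlinarith [sq_nonneg v₁, sq_nonneg v₂, sq_nonneg v₃]
    have h3 : v₃ = 0 := by nlinarith [sq_nonneg v₁, sq_nonneg v₂, sq_nonneg v₃]
    refine hv ⟨?_, h1, h2, h3⟩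
    simp only [h1, h2, h3, mul_zero, add_zero, neg_eq_zero, mul_eq_zero] at htv
    exact htv.resolve_left fun h ↦ by simp [h] at ht0
  -- Cauchy–Schwarz for the spatial parts; the three squares are those of Lagrange's identity.
  have hcs : (t₀ * v₀) ^ 2 ≤ (t₁ ^ 2 + t₂ ^ 2 + t₃ ^ 2) * (v₁ ^ 2 + v₂ ^ 2 + v₃ ^ 2) := by
    have : t₀ * v₀ = t₁ * v₁ + t₂ * v₂ + t₃ * v₃ := by linarith
    rw [this]
    nlinarith [sq_nonneg (t₁ * v₂ - t₂ * v₁), sq_nonneg (t₁ * v₃ - t₃ * v₁),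
      sq_nonneg (t₂ * v₃ - t₃ * v₂)]
  have hlt : (t₁ ^ 2 + t₂ ^ 2 + t₃ ^ 2) * (v₁ ^ 2 + v₂ ^ 2 + v₃ ^ 2)
      < t₀ ^ 2 * (v₁ ^ 2 + v₂ ^ 2 + v₃ ^ 2) := by
    gcongr
    linarith
  have : t₀ ^ 2 * v₀ ^ 2 < t₀ ^ 2 * (v₁ ^ 2 + v₂ ^ 2 + v₃ ^ 2) := by
    rw [← mul_pow]
    exact hcs.trans_lt hlt
  have := lt_of_mul_lt_mul_left this ht0.le
  linarith

/-- In a basis supplied by `lorentzian` the claim becomes the one for Minkowski space. -/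
theorem LorentzMetric.isLorentzForm_form (g : LorentzMetric M) (x : M) :
    IsLorentzForm (g.form x) := by
  refine ⟨g.symm x, ?_⟩
  obtain ⟨b, hb⟩ := g.lorentzian x
  have key : ∀ v w : TangentSpace (𝓡 4) x,
      g.val x v w = -(b.repr v 0 * b.repr w 0) + b.repr v 1 * b.repr w 1
      + b.repr v 2 * b.repr w 2 + b.repr v 3 * b.repr w 3 := by
    intro v w
    conv_lhs => rw [← b.sum_repr v, ← b.sum_repr w]
    simp only [Fin.sum_univ_four, map_add, map_smul, add_apply, smul_apply, hb, smul_eq_mul]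
    simp
    ring
  have hpos : ∀ T v : TangentSpace (𝓡 4) x, g.val x T T < 0 → g.val x T v = 0 → v ≠ 0 →
      0 < g.val x v v := by
    intro T v hT hTv hv
    rw [key] at hT hTv ⊢
    refine minkowski_pos_of_orthogonal hT hTv fun hcon ↦ hv ?_
    have : b.repr v = 0 := by
      ext i
      fin_cases i
      exacts [hcon.1, hcon.2.1, hcon.2.2.1, hcon.2.2.2]
    exact b.repr.map_eq_zero_iff.1 this
  exact hpos

theorem IsLorentzForm.bilinearComp {B : 𝔼 →L[ℝ] 𝔼 →L[ℝ] ℝ} (hB : IsLorentzForm B) {L : 𝔼 →L[ℝ] 𝔼}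
    (hL : Function.Injective L) : IsLorentzForm (B.bilinearComp L L) where
  symm v w := hB.symm _ _
  pos T v hT hTv hv := hB.pos (L T) (L v) hT hTv fun h ↦ hv (hL (by rw [h, map_zero]))

theorem LorentzMetric.isLorentzForm_chartMetric (g : LorentzMetric M) (x₀ : M) {y : 𝔼}
    (hy : y ∈ (extChartAt (𝓡 4) x₀).target) : IsLorentzForm (g.chartMetric x₀ y) :=
  (g.isLorentzForm_form _).bilinearComp (injective_chartSymmDeriv x₀ hy)

end ChartMetric

/-! ### Curves and geodesics in charts. -/

section ChartCurves

set_option maxSynthPendingDepth 3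

variable {M : Type*} [TopologicalSpace M] [ChartedSpace (EuclideanSpace ℝ (Fin 4)) M]
  [IsManifold (𝓡 4) ∞ M]

local notation "𝔼" => EuclideanSpace ℝ (Fin 4)

/-- The change of coordinates from the chart around `x₀` to the chart around `x₁`. -/
noncomputable def chartTransition (x₀ x₁ : M) (y : 𝔼) : 𝔼 :=
  extChartAt (𝓡 4) x₁ ((extChartAt (𝓡 4) x₀).symm y)

theorem contDiffAt_chartTransition {x₀ x₁ : M} {y : 𝔼} (hy : y ∈ (extChartAt (𝓡 4) x₀).target)
    (hy' : (extChartAt (𝓡 4) x₀).symm y ∈ (extChartAt (𝓡 4) x₁).source) :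
    ContDiffAt ℝ 2 (chartTransition x₀ x₁) y := by
  have h1 : ContMDiffAt 𝓘(ℝ, 𝔼) (𝓡 4) ∞ (extChartAt (𝓡 4) x₀).symm y :=
    ((contMDiffOn_extChartAt_symm x₀) y hy).contMDiffAt ((isOpen_extChartAt_target x₀).mem_nhds hy)
  have h2 : ContMDiffAt (𝓡 4) 𝓘(ℝ, 𝔼) ∞ (extChartAt (𝓡 4) x₁) ((extChartAt (𝓡 4) x₀).symm y) :=
    contMDiffAt_extChartAt' (by simpa using hy')
  exact ((contMDiffAt_iff_contDiffAt.1 (h2.comp y h1))).of_le ENat.LEInfty.out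

theorem fderiv_chartTransition {x₀ x₁ : M} {y : 𝔼} (hy : y ∈ (extChartAt (𝓡 4) x₀).target)
    (hy' : (extChartAt (𝓡 4) x₀).symm y ∈ (extChartAt (𝓡 4) x₁).source) (v : 𝔼) :
    fderiv ℝ (chartTransition x₀ x₁) y v =
      chartDeriv x₁ ((extChartAt (𝓡 4) x₀).symm y) (chartSymmDeriv x₀ y v) := by
  have h1 := hasMFDerivAt_extChartAt_symm x₀ hy
  have h2 : HasMFDerivAt (𝓡 4) 𝓘(ℝ, 𝔼) (extChartAt (𝓡 4) x₁) ((extChartAt (𝓡 4) x₀).symm y)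
      (chartDeriv x₁ ((extChartAt (𝓡 4) x₀).symm y)) :=
    (mdifferentiableAt_extChartAt (by simpa using hy')).hasMFDerivAt
  have h3 : HasFDerivAt (chartTransition x₀ x₁)
      (chartDeriv x₁ ((extChartAt (𝓡 4) x₀).symm y) ∘L chartSymmDeriv x₀ y) y :=
    (h2.comp y h1).hasFDerivAt
  rw [h3.fderiv]
  rfl

theorem chartSymmDeriv_fderiv_chartTransition {x₀ x₁ : M} {y : 𝔼}
    (hy : y ∈ (extChartAt (𝓡 4) x₀).target)
    (hy' : (extChartAt (𝓡 4) x₀).symm y ∈ (extChartAt (𝓡 4) x₁).source) (v : 𝔼) :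
    chartSymmDeriv x₁ (chartTransition x₀ x₁ y) (fderiv ℝ (chartTransition x₀ x₁) y v) =
      chartSymmDeriv x₀ y v := by
  rw [fderiv_chartTransition hy hy']
  exact chartSymmDeriv_chartDeriv hy' _

theorem surjective_fderiv_chartTransition {x₀ x₁ : M} {y : 𝔼}
    (hy : y ∈ (extChartAt (𝓡 4) x₀).target)
    (hy' : (extChartAt (𝓡 4) x₀).symm y ∈ (extChartAt (𝓡 4) x₁).source) :
    Function.Surjective (fderiv ℝ (chartTransition x₀ x₁) y) := by
  intro w
  have h1 := chartSymmDeriv_chartDeriv ((extChartAt (𝓡 4) x₀).map_target hy)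
    (chartSymmDeriv x₁ (chartTransition x₀ x₁ y) w)
  rw [(extChartAt (𝓡 4) x₀).right_inv hy] at h1
  refine ⟨chartDeriv x₀ ((extChartAt (𝓡 4) x₀).symm y)
    (chartSymmDeriv x₁ (chartTransition x₀ x₁ y) w), ?_⟩
  rw [fderiv_chartTransition hy hy', h1]
  exact chartDeriv_chartSymmDeriv hy' w

theorem LorentzMetric.chartMetric_transition (g : LorentzMetric M) {x₀ x₁ : M} {y : 𝔼}
    (hy : y ∈ (extChartAt (𝓡 4) x₀).target)
    (hy' : (extChartAt (𝓡 4) x₀).symm y ∈ (extChartAt (𝓡 4) x₁).source) (v w : 𝔼) :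
    g.chartMetric x₀ y v w = g.chartMetric x₁ (chartTransition x₀ x₁ y)
      (fderiv ℝ (chartTransition x₀ x₁) y v) (fderiv ℝ (chartTransition x₀ x₁) y w) := by
  simp only [LorentzMetric.chartMetric, ContinuousLinearMap.bilinearComp_apply,
    chartSymmDeriv_fderiv_chartTransition hy hy']
  rw [chartTransition, (extChartAt (𝓡 4) x₁).left_inv hy']

/-- The velocity of a curve in terms of its coordinate representation. -/
theorem velocity_eq {c : ℝ → M} {J : Set ℝ} {s : ℝ} {x₀ : M}
    (hc : MDifferentiableWithinAt 𝓘(ℝ, ℝ) (𝓡 4) c J s) (hs : s ∈ J)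
    (hJ : UniqueDiffWithinAt ℝ J s) (hx : c s ∈ (extChartAt (𝓡 4) x₀).source) :
    DifferentiableWithinAt ℝ (fun r ↦ extChartAt (𝓡 4) x₀ (c r)) J s ∧
    velocity c J s = chartSymmDeriv x₀ (extChartAt (𝓡 4) x₀ (c s))
      (derivWithin (fun r ↦ extChartAt (𝓡 4) x₀ (c r)) J s) := by
  have h1 : MDifferentiableWithinAt 𝓘(ℝ, ℝ) 𝓘(ℝ, 𝔼) (fun r ↦ extChartAt (𝓡 4) x₀ (c r)) J s :=
    (mdifferentiableAt_extChartAt (by simpa using hx)).comp_mdifferentiableWithinAt s hc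
  have h2 := h1.differentiableWithinAt
  refine ⟨h2, ?_⟩
  have h3 : HasMFDerivWithinAt 𝓘(ℝ, ℝ) 𝓘(ℝ, 𝔼) (fun r ↦ extChartAt (𝓡 4) x₀ (c r)) J s
      (fderivWithin ℝ (fun r ↦ extChartAt (𝓡 4) x₀ (c r)) J s) :=
    h2.hasFDerivWithinAt.hasMFDerivWithinAt
  have h4 := (hasMFDerivAt_extChartAt_symm x₀ ((extChartAt (𝓡 4) x₀).map_source hx)
    ).comp_hasMFDerivWithinAt s h3
  -- Near `s` the curve is the inverse chart composed with its coordinate form, so the chain rule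
  -- applies.
  have h5 : c =ᶠ[𝓝[J] s] (extChartAt (𝓡 4) x₀).symm ∘ fun r ↦ extChartAt (𝓡 4) x₀ (c r) := by
    filter_upwards [hc.continuousWithinAt.preimage_mem_nhdsWithin
      ((isOpen_extChartAt_source x₀).mem_nhds hx)] with r hr
    exact ((extChartAt (𝓡 4) x₀).left_inv hr).symm
  have h6 := (h4.congr_of_eventuallyEq h5 (h5.self_of_nhdsWithin hs)).mfderivWithin
    hJ.uniqueMDiffWithinAt
  exact DFunLike.congr_fun h6 (1 : ℝ)

/-- A curve that satisfies the geodesic equation in one chart is a geodesic. -/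
theorem LorentzMetric.isGeodesicOn_of_chart (g : LorentzMetric M) (x₀ : M) {u w : ℝ → 𝔼}
    (hu : ContDiffOn ℝ 2 u (Set.Icc 0 1))
    (hut : ∀ s ∈ Set.Icc (0 : ℝ) 1, u s ∈ (extChartAt (𝓡 4) x₀).target)
    (hpos : ∀ s ∈ Set.Icc (0 : ℝ) 1, HasDerivWithinAt u (w s) (Set.Icc 0 1) s)
    (hacc : ∀ s ∈ Set.Icc (0 : ℝ) 1, ∃ a, HasDerivWithinAt w a (Set.Icc 0 1) s ∧
      ∀ x, g.chartMetric x₀ (u s) a x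
        + metricChristoffel (g.chartMetric x₀) (u s) (w s) (w s) x = 0) :
    g.IsGeodesicOn (fun s ↦ (extChartAt (𝓡 4) x₀).symm (u s)) (Set.Icc 0 1) := by
  have hcs : ContMDiffOn 𝓘(ℝ, ℝ) (𝓡 4) 2 (fun s ↦ (extChartAt (𝓡 4) x₀).symm (u s)) (Set.Icc 0 1) :=
    ((contMDiffOn_extChartAt_symm (n := ∞) x₀).of_le ENat.LEInfty.out).comp hu.contMDiffOn hut
  refine ⟨hcs, fun x₁ s hs hsx ↦ ?_⟩
  intro v v' v'' x'
  have hy := hut s hs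
  obtain ⟨a, ha, hgeo⟩ := hacc s hs
  have hψ := contDiffAt_chartTransition hy hsx
  obtain ⟨h1, h2⟩ := derivWithin_comp_curve (v := v) hs (uniqueDiffOn_Icc zero_lt_one) hpos ha hψ
    (Filter.Eventually.of_forall fun r ↦ rfl)
  have hy1 : chartTransition x₀ x₁ (u s) ∈ (extChartAt (𝓡 4) x₁).target :=
    (extChartAt (𝓡 4) x₁).map_source hsx
  have hmem : ∀ᶠ z in 𝓝 (u s), z ∈ (extChartAt (𝓡 4) x₀).target ∧
      (extChartAt (𝓡 4) x₀).symm z ∈ (extChartAt (𝓡 4) x₁).source :=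
    ((isOpen_extChartAt_target x₀).mem_nhds hy |> Filter.eventually_mem_set.2).and
      ((continuousAt_extChartAt_symm'' hy).eventually
        ((isOpen_extChartAt_source x₁).mem_nhds hsx))
  -- Every test vector in the chart around `x₁` is the image of one in the chart around `x₀`, where
  -- the equation is known.
  obtain ⟨x, rfl⟩ := surjective_fderiv_chartTransition hy hsx x'
  have h3 := geodesic_equation_transform
    ((g.contDiffAt_chartMetric x₀ hy).differentiableAt (by norm_num))
    ((g.contDiffAt_chartMetric x₁ hy1).differentiableAt (by norm_num)) hψ
    (g.isLorentzForm_chartMetric x₁ hy1).symm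
    (hmem.mono fun z hz v w ↦ g.chartMetric_transition hz.1 hz.2 v w) (w s) a x
  rw [hgeo] at h3
  have hvs : v s = chartTransition x₀ x₁ (u s) := rfl
  have hv' : v' s = _ := h1
  have hv'' : v'' s = _ := h2
  rw [hv', hv'', hvs, g.christoffel_eq x₁ hy1, ← g.chartMetric_apply]
  exact h3.symm

end ChartCurves

/-! ### Regularity of null rays. -/

section NullRayRegularity

set_option maxSynthPendingDepth 3

variable {E : Type*} [NormedAddCommGroup E] [NormedSpace ℝ E]

/-- The acceleration equals the spray along the curve, hence is continuous. -/
theorem IsNullRay.contDiffOn [CompleteSpace E] {G : E → E →L[ℝ] E →L[ℝ] ℝ} {T : E} {V S : Set E}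
    {q : E} {u w : ℝ → E} (h : IsNullRay G T V S q u w) (hG : ∀ y ∈ V, ContDiffAt ℝ 2 G y)
    (hV : ∀ y ∈ V, (G y).IsInvertible) : ContDiffOn ℝ 2 u (Set.Icc 0 1) := by
  have hs := h.isSpraySolution hV
  have huniq : UniqueDiffOn ℝ (Set.Icc (0 : ℝ) 1) := uniqueDiffOn_Icc zero_lt_one
  have hw : ContDiffOn ℝ 1 w (Set.Icc 0 1) := by
    rw [contDiffOn_one_iff_derivWithin huniq]
    refine ⟨fun s hs' ↦ (hs.vel s hs').differentiableWithinAt, ?_⟩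
    have hc : ContinuousOn (fun s ↦ geodesicSpray G (u s) (w s) (w s)) (Set.Icc 0 1) := by
      intro s hs'
      have h1 : ContinuousWithinAt (fun s ↦ geodesicSpray G (u s)) (Set.Icc 0 1) s :=
        (contDiffAt_geodesicSpray (hG _ (h.stays s hs'))
          (hV _ (h.stays s hs'))).continuousAt.comp_continuousWithinAt
          (hs.pos s hs').continuousWithinAt
      have h2 := (hs.vel s hs').continuousWithinAt
      exact (h1.clm_apply h2).clm_apply h2
    exact hc.congr fun s hs' ↦ (hs.vel s hs').derivWithin (huniq s hs')
  have h2 : ContDiffOn ℝ (1 + 1) u (Set.Icc 0 1) := by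
    rw [contDiffOn_succ_iff_derivWithin huniq]
    refine ⟨fun s hs' ↦ (hs.pos s hs').differentiableWithinAt, by simp, ?_⟩
    exact hw.congr fun s hs' ↦ (hs.pos s hs').derivWithin (huniq s hs')
  rwa [one_add_one_eq_two] at h2

end NullRayRegularity

/-! ### Comparison of time cones. -/

section Cones

set_option maxSynthPendingDepth 3

variable {E : Type*} [NormedAddCommGroup E] [NormedSpace ℝ E]

/-- A timelike vector in a time cone determines which causal vectors point in its direction. -/
theorem IsLorentzForm.forall_cone_neg_iff {B : E →L[ℝ] E →L[ℝ] ℝ} (hB : IsLorentzForm B)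
    {u₀ X T v : E} (hu₀ : B u₀ u₀ < 0) (hX : B X X < 0) (huX : B u₀ X < 0) (hT : B T T < 0)
    (hXT : B X T < 0) (hv : B v v ≤ 0) :
    (∀ u, B u u < 0 ∧ B u₀ u < 0 → B u v < 0) ↔ B T v < 0 := by
  -- `X` links `u₀` and `T`: both lie in its time cone, hence in the same one.
  have huT : B u₀ T < 0 := hB.apply_neg hX hu₀.le (by rwa [hB.symm]) hT hXT
  refine ⟨fun h ↦ h T ⟨hT, huT⟩, fun h u hu ↦ ?_⟩
  have hTu : B T u < 0 := hB.apply_neg hu₀ hT.le huT hu.1 hu.2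
  rw [hB.symm]
  exact hB.apply_neg hT hv h hu.1 hTu

end Cones

/-! ### Coordinate balls and the trace of an embedded curve. -/

section ChartNeighborhoods

variable {M : Type*} [TopologicalSpace M] [ChartedSpace (EuclideanSpace ℝ (Fin 4)) M]

/-- The coordinate ball of radius `r` around `x₀`. -/
def chartBall (x₀ : M) (r : ℝ) : Set M :=
  (extChartAt (𝓡 4) x₀).source ∩
    extChartAt (𝓡 4) x₀ ⁻¹' Metric.ball (extChartAt (𝓡 4) x₀ x₀) r

theorem isOpen_chartBall (x₀ : M) (r : ℝ) : IsOpen (chartBall x₀ r) :=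
  (continuousOn_extChartAt x₀).isOpen_inter_preimage (isOpen_extChartAt_source x₀)
    Metric.isOpen_ball

theorem mem_chartBall_self (x₀ : M) {r : ℝ} (hr : 0 < r) : x₀ ∈ chartBall x₀ r :=
  ⟨mem_extChartAt_source x₀, Metric.mem_ball_self hr⟩

/-- Near `γ t₀` only parameter values close to `t₀` occur on an embedded curve. -/
theorem eventually_mem_image_chart {I : Set ℝ} {γ : ℝ → M}
    (hγ : Topology.IsEmbedding (fun t : I ↦ γ t)) {t₀ : ℝ} (ht₀ : t₀ ∈ I) {η : ℝ} (hη : 0 < η) :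
    ∀ᶠ x in 𝓝 (extChartAt (𝓡 4) (γ t₀) (γ t₀)),
      x ∈ extChartAt (𝓡 4) (γ t₀) '' (γ '' I ∩ (extChartAt (𝓡 4) (γ t₀)).source) →
        ∃ t, |t - t₀| < η ∧ extChartAt (𝓡 4) (γ t₀) (γ t) = x := by
  have hO : {t : I | |(t : ℝ) - t₀| < η} ∈ 𝓝 (⟨t₀, ht₀⟩ : I) := by
    have hc : Continuous (fun t : I ↦ |(t : ℝ) - t₀|) := by fun_prop
    exact hc.continuousAt.eventually_lt_const (by simpa using hη)
  -- The topology of `I` is induced by the curve, which prevents remote parameters from returning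
  -- close to `γ t₀`.
  rw [hγ.isInducing.nhds_eq_comap, Filter.mem_comap] at hO
  obtain ⟨O, hO, hsub⟩ := hO
  have h := continuousAt_extChartAt_symm'' (mem_extChartAt_target (I := 𝓡 4) (γ t₀))
  rw [ContinuousAt, (extChartAt (𝓡 4) (γ t₀)).left_inv (mem_extChartAt_source (γ t₀))] at h
  filter_upwards [h.eventually (Filter.eventually_mem_set.2 hO)] with x hx
  rintro ⟨_, ⟨⟨t, ht, rfl⟩, hts⟩, rfl⟩
  rw [(extChartAt (𝓡 4) (γ t₀)).left_inv hts] at hx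
  exact ⟨t, hsub (show (⟨t, ht⟩ : I) ∈ (fun t : I ↦ γ t) ⁻¹' O from hx), rfl⟩

end ChartNeighborhoods

/-! ### Light rays correspond to null rays in coordinates. -/

section LightRays

set_option maxSynthPendingDepth 3

variable {M : Type*} [TopologicalSpace M] [ChartedSpace (EuclideanSpace ℝ (Fin 4)) M]
  [IsManifold (𝓡 4) ∞ M]

local notation "𝔼" => EuclideanSpace ℝ (Fin 4)

theorem LorentzMetric.val_chartSymmDeriv (g : LorentzMetric M) {x₀ x : M}
    (hx : x ∈ (extChartAt (𝓡 4) x₀).source) (a b : 𝔼) :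
    g.form x (chartSymmDeriv x₀ (extChartAt (𝓡 4) x₀ x) a)
      (chartSymmDeriv x₀ (extChartAt (𝓡 4) x₀ x) b)
      = g.chartMetric x₀ (extChartAt (𝓡 4) x₀ x) a b := by
  simp only [LorentzMetric.chartMetric, ContinuousLinearMap.bilinearComp_apply,
    (extChartAt (𝓡 4) x₀).left_inv hx]

theorem chartSymmDeriv_eq_zero_iff {x₀ x : M} (hx : x ∈ (extChartAt (𝓡 4) x₀).source) (a : 𝔼) :
    chartSymmDeriv x₀ (extChartAt (𝓡 4) x₀ x) a = 0 ↔ a = 0 :=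
  map_eq_zero_iff _ (injective_chartSymmDeriv x₀ ((extChartAt (𝓡 4) x₀).map_source hx))

/-- On the coordinate ball of radius `R`, the predicate `F` on tangent vectors singles out the
causal vectors in the time cone of the timelike coordinate vector `T`. -/
structure IsConeNear (g : LorentzMetric M) (x₀ : M) (F : ∀ x : M, TangentSpace (𝓡 4) x → Prop)
    (T : 𝔼) (R : ℝ) : Prop where
  subset_target : Metric.ball (extChartAt (𝓡 4) x₀ x₀) R ⊆ (extChartAt (𝓡 4) x₀).target
  timelike : ∀ y ∈ Metric.ball (extChartAt (𝓡 4) x₀ x₀) R, g.chartMetric x₀ y T T < 0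
  iff : ∀ x ∈ chartBall x₀ R, ∀ v : 𝔼, F x (chartSymmDeriv x₀ (extChartAt (𝓡 4) x₀ x) v) ↔
    v ≠ 0 ∧ g.chartMetric x₀ (extChartAt (𝓡 4) x₀ x) v v ≤ 0 ∧
      g.chartMetric x₀ (extChartAt (𝓡 4) x₀ x) T v < 0

theorem IsConeNear.mono {g : LorentzMetric M} {x₀ : M} {F : ∀ x : M, TangentSpace (𝓡 4) x → Prop}
    {T : 𝔼} {R r : ℝ} (h : IsConeNear g x₀ F T R) (hr : r ≤ R) : IsConeNear g x₀ F T r where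
  subset_target := (Metric.ball_subset_ball hr).trans h.subset_target
  timelike y hy := h.timelike y (Metric.ball_subset_ball hr hy)
  iff x hx := h.iff x ⟨hx.1, Metric.ball_subset_ball hr hx.2⟩

theorem IsConeNear.isInvertible {g : LorentzMetric M} {x₀ : M}
    {F : ∀ x : M, TangentSpace (𝓡 4) x → Prop} {T : 𝔼} {R : ℝ} (h : IsConeNear g x₀ F T R) {y : 𝔼}
    (hy : y ∈ Metric.ball (extChartAt (𝓡 4) x₀ x₀) R) : (g.chartMetric x₀ y).IsInvertible :=
  isInvertible_of_injective
    ((g.isLorentzForm_chartMetric x₀ (h.subset_target hy)).injective (h.timelike y hy))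

/-- The coordinate representation of a light ray is a null ray. -/
theorem LorentzMetric.IsLightRayWithin.isNullRay {g : LorentzMetric M} {x₀ : M}
    {F : ∀ x : M, TangentSpace (𝓡 4) x → Prop} {T : 𝔼} {r : ℝ} (hF : IsConeNear g x₀ F T r)
    {q : M} {S : Set M} {c : ℝ → M} (hc : g.IsLightRayWithin (chartBall x₀ r) q S c)
    (hcF : ∀ s ∈ Set.Icc (0 : ℝ) 1, F (c s) (velocity c (Set.Icc 0 1) s)) :
    IsNullRay (g.chartMetric x₀) T (Metric.ball (extChartAt (𝓡 4) x₀ x₀) r)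
      (extChartAt (𝓡 4) x₀ '' (S ∩ (extChartAt (𝓡 4) x₀).source)) (extChartAt (𝓡 4) x₀ q)
      (fun s ↦ extChartAt (𝓡 4) x₀ (c s))
      (derivWithin (fun s ↦ extChartAt (𝓡 4) x₀ (c s)) (Set.Icc 0 1)) := by
  have huniq : UniqueDiffOn ℝ (Set.Icc (0 : ℝ) 1) := uniqueDiffOn_Icc zero_lt_one
  have hsrc : ∀ s ∈ Set.Icc (0 : ℝ) 1, c s ∈ (extChartAt (𝓡 4) x₀).source := fun s hs ↦
    (hc.stays s hs).1
  have hmd : ∀ s ∈ Set.Icc (0 : ℝ) 1,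
      MDifferentiableWithinAt 𝓘(ℝ, ℝ) (𝓡 4) c (Set.Icc 0 1) s := fun s hs ↦
    (hc.geodesic.1 s hs).mdifferentiableWithinAt (by norm_num)
  have hu : ContDiffOn ℝ 2 (fun s ↦ extChartAt (𝓡 4) x₀ (c s)) (Set.Icc 0 1) := by
    rw [← contMDiffOn_iff_contDiffOn]
    refine ((contMDiffOn_extChartAt (n := ∞) (x := x₀)).of_le ENat.LEInfty.out).comp hc.geodesic.1
      fun s hs ↦ ?_
    simpa using hsrc s hs
  have hu1 : DifferentiableOn ℝ (derivWithin (fun s ↦ extChartAt (𝓡 4) x₀ (c s)) (Set.Icc 0 1))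
      (Set.Icc 0 1) := by
    have h : ContDiffOn ℝ (1 + 1) (fun s ↦ extChartAt (𝓡 4) x₀ (c s)) (Set.Icc 0 1) := by
      rwa [one_add_one_eq_two]
    exact ((contDiffOn_succ_iff_derivWithin huniq).1 h).2.2.differentiableOn one_ne_zero
  have hvel := fun s (hs : s ∈ Set.Icc (0 : ℝ) 1) ↦
    (velocity_eq (hmd s hs) hs (huniq s hs) (hsrc s hs))
  refine ⟨fun s hs ↦ (hvel s hs).1.hasDerivWithinAt,
    fun s hs ↦ ⟨_, (hu1 s hs).hasDerivWithinAt, fun x ↦ ?_⟩, fun s hs ↦ ?_, fun s hs ↦ ?_, ?_,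
    ⟨c 1, ⟨hc.finish, hsrc 1 (by simp)⟩, rfl⟩, fun s hs ↦ (hc.stays s hs).2⟩
  · have h := hc.geodesic.2 x₀ s hs (hsrc s hs) x
    rw [g.christoffel_eq x₀ ((extChartAt (𝓡 4) x₀).map_source (hsrc s hs)),
      ← g.chartMetric_apply] at h
    exact h
  · have h := (hc.lightlike s hs).2
    rw [(hvel s hs).2] at h
    rw [← g.val_chartSymmDeriv (hsrc s hs)]
    exact h
  · have h := hcF s hs
    rw [(hvel s hs).2, hF.iff _ (hc.stays s hs)] at h
    exact h.2.2
  · simp only [hc.start]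

/-- A null ray in coordinates gives a light ray. -/
theorem IsNullRay.isLightRayWithin {g : LorentzMetric M} {x₀ : M}
    {F : ∀ x : M, TangentSpace (𝓡 4) x → Prop} {T : 𝔼} {r : ℝ} (hF : IsConeNear g x₀ F T r)
    {q : M} (hq : q ∈ (extChartAt (𝓡 4) x₀).source) {S : Set M} {u w : ℝ → 𝔼}
    (hc : IsNullRay (g.chartMetric x₀) T (Metric.ball (extChartAt (𝓡 4) x₀ x₀) r)
      (extChartAt (𝓡 4) x₀ '' (S ∩ (extChartAt (𝓡 4) x₀).source)) (extChartAt (𝓡 4) x₀ q) u w) :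
    g.IsLightRayWithin (chartBall x₀ r) q S (fun s ↦ (extChartAt (𝓡 4) x₀).symm (u s)) ∧
    ∀ s ∈ Set.Icc (0 : ℝ) 1, F ((extChartAt (𝓡 4) x₀).symm (u s))
      (velocity (fun s ↦ (extChartAt (𝓡 4) x₀).symm (u s)) (Set.Icc 0 1) s) := by
  have huniq : UniqueDiffOn ℝ (Set.Icc (0 : ℝ) 1) := uniqueDiffOn_Icc zero_lt_one
  have hut : ∀ s ∈ Set.Icc (0 : ℝ) 1, u s ∈ (extChartAt (𝓡 4) x₀).target := fun s hs ↦
    hF.subset_target (hc.stays s hs)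
  have hri : ∀ s ∈ Set.Icc (0 : ℝ) 1,
      extChartAt (𝓡 4) x₀ ((extChartAt (𝓡 4) x₀).symm (u s)) = u s := fun s hs ↦
    (extChartAt (𝓡 4) x₀).right_inv (hut s hs)
  have hsrc : ∀ s ∈ Set.Icc (0 : ℝ) 1,
      (extChartAt (𝓡 4) x₀).symm (u s) ∈ (extChartAt (𝓡 4) x₀).source := fun s hs ↦
    (extChartAt (𝓡 4) x₀).map_target (hut s hs)
  have hstay : ∀ s ∈ Set.Icc (0 : ℝ) 1, (extChartAt (𝓡 4) x₀).symm (u s) ∈ chartBall x₀ r :=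
    fun s hs ↦ ⟨hsrc s hs, by rw [Set.mem_preimage, hri s hs]; exact hc.stays s hs⟩
  have hu := hc.contDiffOn (fun y hy ↦ g.contDiffAt_chartMetric x₀ (hF.subset_target hy))
    fun y hy ↦ hF.isInvertible hy
  have hgeo := g.isGeodesicOn_of_chart x₀ hu hut hc.pos hc.acc
  have hvel : ∀ s ∈ Set.Icc (0 : ℝ) 1,
      velocity (fun s ↦ (extChartAt (𝓡 4) x₀).symm (u s)) (Set.Icc 0 1) s =
      chartSymmDeriv x₀ (extChartAt (𝓡 4) x₀ ((extChartAt (𝓡 4) x₀).symm (u s))) (w s) := by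
    intro s hs
    have h := (velocity_eq (x₀ := x₀) ((hgeo.1 s hs).mdifferentiableWithinAt (by norm_num)) hs
      (huniq s hs) (hsrc s hs)).2
    rw [h, derivWithin_congr (fun r hr ↦ hri r hr) (hri s hs), (hc.pos s hs).derivWithin (huniq s hs)]
  have hw0 : ∀ s ∈ Set.Icc (0 : ℝ) 1, w s ≠ 0 := by
    intro s hs h0
    have := hc.future s hs
    simp [h0] at this
  refine ⟨⟨hgeo, fun s hs ↦ ⟨?_, ?_⟩, ?_, ?_, hstay⟩, fun s hs ↦ ?_⟩
  · rw [hvel s hs]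
    exact fun h ↦ hw0 s hs ((chartSymmDeriv_eq_zero_iff (hsrc s hs) _).1 h)
  · rw [hvel s hs]
    have h := g.val_chartSymmDeriv (hsrc s hs) (w s) (w s)
    rw [hri s hs, hc.null s hs] at h
    rw [hri s hs]
    exact h
  · simp only [hc.start]
    exact (extChartAt (𝓡 4) x₀).left_inv hq
  · obtain ⟨x, ⟨hxS, hxs⟩, hx⟩ := hc.finish
    simp only [← hx, (extChartAt (𝓡 4) x₀).left_inv hxs]
    exact hxS
  · rw [hvel s hs, hF.iff _ (hstay s hs), hri s hs]
    exact ⟨hw0 s hs, (hc.null s hs).le, hc.future s hs⟩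

/-- Existence and uniqueness of light rays of the time cone `F` to a curve in the time cone `F`. -/
theorem exists_unique_lightRay {g : LorentzMetric M} {x₀ : M}
    {F : ∀ x : M, TangentSpace (𝓡 4) x → Prop} {T : 𝔼} {R₀ : ℝ} (hR₀ : 0 < R₀)
    (hF : IsConeNear g x₀ F T R₀) {S : Set M} {β : ℝ → 𝔼} {t₀ : ℝ} (hβ : HasStrictDerivAt β T t₀)
    (hβ0 : β t₀ = extChartAt (𝓡 4) x₀ x₀)
    (hS₁ : ∀ᶠ t in 𝓝 t₀, β t ∈ extChartAt (𝓡 4) x₀ '' (S ∩ (extChartAt (𝓡 4) x₀).source))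
    (hS₂ : ∀ η > 0, ∀ᶠ x in 𝓝 (extChartAt (𝓡 4) x₀ x₀),
      x ∈ extChartAt (𝓡 4) x₀ '' (S ∩ (extChartAt (𝓡 4) x₀).source) →
        ∃ t, |t - t₀| < η ∧ β t = x) :
    ∃ R > 0, ∀ r > 0, r ≤ R → ∀ᶠ q in 𝓝 x₀, q ∉ S → ∃ c : ℝ → M,
      (g.IsLightRayWithin (chartBall x₀ r) q S c ∧
        ∀ s ∈ Set.Icc (0 : ℝ) 1, F (c s) (velocity c (Set.Icc 0 1) s)) ∧
      ∀ c' : ℝ → M, (g.IsLightRayWithin (chartBall x₀ r) q S c' ∧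
        ∀ s ∈ Set.Icc (0 : ℝ) 1, F (c' s) (velocity c' (Set.Icc 0 1) s)) →
        Set.EqOn c' c (Set.Icc 0 1) := by
  have htgt : (extChartAt (𝓡 4) x₀).target ∈ 𝓝 (extChartAt (𝓡 4) x₀ x₀) :=
    (isOpen_extChartAt_target x₀).mem_nhds (mem_extChartAt_target x₀)
  have hG := g.contDiffAt_chartMetric x₀ (mem_extChartAt_target x₀)
  have hL : ∀ᶠ y in 𝓝 (extChartAt (𝓡 4) x₀ x₀), IsLorentzForm (g.chartMetric x₀ y) :=
    Filter.eventually_of_mem htgt fun y hy ↦ g.isLorentzForm_chartMetric x₀ hy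
  have hT := hF.timelike _ (Metric.mem_ball_self hR₀)
  obtain ⟨R, hR, huniq⟩ := exists_ball_nullRay_unique hG hL hT hβ hS₂
  -- Every smaller radius is allowed, so that the future and the past case can later share one ball.
  refine ⟨min R R₀, lt_min hR hR₀, fun r hr hrR ↦ ?_⟩
  have hFr := hF.mono (hrR.trans (min_le_right _ _))
  have hsub : Metric.ball (extChartAt (𝓡 4) x₀ x₀) r ⊆ Metric.ball (extChartAt (𝓡 4) x₀ x₀) R :=
    Metric.ball_subset_ball (hrR.trans (min_le_left _ _))
  filter_upwards [(continuousAt_extChartAt x₀).eventually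
    (eventually_exists_nullRay hG hL hT hβ hβ0 hS₁ hr), extChartAt_source_mem_nhds (I := 𝓡 4) x₀]
    with q hq hqs hqS
  obtain ⟨u, w, huw⟩ := hq (by
    rintro ⟨x, ⟨hxS, hxs⟩, hx⟩
    exact hqS ((extChartAt (𝓡 4) x₀).injOn hxs hqs hx ▸ hxS))
  refine ⟨_, huw.isLightRayWithin hFr hqs, fun c' hc' s hs ↦ ?_⟩
  have h := huniq _ _ _ _ _ (huw.mono hsub) ((hc'.1.isNullRay hFr hc'.2).mono hsub) hs
  simp only [← h]
  exact ((extChartAt (𝓡 4) x₀).left_inv (hc'.1.stays s hs).1).symm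

end LightRays

/-! ### The time orientation in coordinates. -/

section Orientation

set_option maxSynthPendingDepth 3

variable {M : Type*} [TopologicalSpace M] [ChartedSpace (EuclideanSpace ℝ (Fin 4)) M]
  [IsManifold (𝓡 4) ∞ M]

local notation "𝔼" => EuclideanSpace ℝ (Fin 4)

/-- A continuous vector field has continuous coordinates. -/
theorem continuousAt_chartDeriv_apply {x₀ : M} {W : Set M} (hW : W ∈ 𝓝 x₀)
    {X : ∀ y : M, TangentSpace (𝓡 4) y}
    (hX : ContinuousOn (fun y : M ↦ (⟨y, X y⟩ : TangentBundle (𝓡 4) M)) W) :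
    ContinuousAt (fun x ↦ chartDeriv x₀ x (X x)) x₀ := by
  set e := trivializationAt 𝔼 (TangentSpace (𝓡 4)) x₀ with he
  have h1 : ContinuousAt (fun y : M ↦ (⟨y, X y⟩ : TangentBundle (𝓡 4) M)) x₀ :=
    hX.continuousAt hW
  have h2 : ContinuousAt (fun y : M ↦ (e ⟨y, X y⟩).2) x₀ := by
    have h3 : ContinuousAt e (⟨x₀, X x₀⟩ : TangentBundle (𝓡 4) M) :=
      e.continuousAt (by rw [e.mem_source]; exact FiberBundle.mem_baseSet_trivializationAt' x₀)
    exact continuousAt_snd.comp (h3.comp_of_eq h1 rfl)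
  refine h2.congr ?_
  filter_upwards [extChartAt_source_mem_nhds (I := 𝓡 4) x₀] with x hx
  have hx' : x ∈ (chartAt 𝔼 x₀).source := by simpa using hx
  have h4 := TangentBundle.continuousLinearMapAt_trivializationAt (𝕜 := ℝ) (I := 𝓡 4) hx'
  have h5 : e.continuousLinearMapAt ℝ x (X x) = chartDeriv x₀ x (X x) := DFunLike.congr_fun h4 (X x)
  rw [← h5, Trivialization.continuousLinearMapAt_apply_of_mem ℝ]
  simpa [he] using hx

/-- Near `x₀` the time orientation is given by the coordinate vector of a future-pointing timelike
vector at `x₀`. -/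
theorem TimeOrientation.exists_isConeNear {g : LorentzMetric M} (τ : TimeOrientation g) {x₀ : M}
    {T : 𝔼} (hT : g.chartMetric x₀ (extChartAt (𝓡 4) x₀ x₀) T T < 0)
    (hTf : τ.FuturePointing (x := x₀) (chartSymmDeriv x₀ (extChartAt (𝓡 4) x₀ x₀) T)) :
    ∃ R > 0, IsConeNear g x₀ (fun _ v ↦ τ.FuturePointing v) T R := by
  obtain ⟨W, hW, X', hX', hXc'⟩ := τ.consistent x₀
  -- The field is retyped with values in the model space, to which each tangent space is
  -- definitionally equal.
  obtain ⟨X, hXd, hXc⟩ : ∃ X : M → 𝔼, ContinuousAt (fun x ↦ chartDeriv x₀ x (X x)) x₀ ∧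
      ∀ y ∈ W, X y ∈ τ.futureCone y := ⟨X', continuousAt_chartDeriv_apply hW hX', hXc'⟩
  have hsrc := mem_extChartAt_source (I := 𝓡 4) x₀
  have htgt := mem_extChartAt_target (I := 𝓡 4) x₀
  have hGc : ContinuousAt (fun x ↦ g.chartMetric x₀ (extChartAt (𝓡 4) x₀ x)) x₀ :=
    ContinuousAt.comp (g := g.chartMetric x₀) (g.contDiffAt_chartMetric x₀ htgt).continuousAt
      (continuousAt_extChartAt x₀)
  -- At `x₀` the vector `T` lies in the cone of the orienting field; this inequality and `hT` are
  -- open conditions and persist on a ball.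
  have hXT0 : g.chartMetric x₀ (extChartAt (𝓡 4) x₀ x₀) (chartDeriv x₀ x₀ (X x₀)) T < 0 := by
    rw [← g.val_chartSymmDeriv hsrc, chartSymmDeriv_chartDeriv hsrc]
    exact hTf.2.2 _ (hXc x₀ (mem_of_mem_nhds hW))
  have hev1 : ∀ᶠ x in 𝓝 x₀,
      g.chartMetric x₀ (extChartAt (𝓡 4) x₀ x) (chartDeriv x₀ x (X x)) T < 0 :=
    ((hGc.clm_apply hXd).clm_apply continuousAt_const).eventually_lt_const hXT0
  have hev2 : ∀ᶠ y in 𝓝 (extChartAt (𝓡 4) x₀ x₀), g.chartMetric x₀ y T T < 0 :=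
    (((g.contDiffAt_chartMetric x₀ htgt).continuousAt.clm_apply
      continuousAt_const).clm_apply continuousAt_const).eventually_lt_const hT
  have hev3 : ∀ᶠ y in 𝓝 (extChartAt (𝓡 4) x₀ x₀), (extChartAt (𝓡 4) x₀).symm y ∈ W ∧
      g.chartMetric x₀ (extChartAt (𝓡 4) x₀ ((extChartAt (𝓡 4) x₀).symm y))
        (chartDeriv x₀ ((extChartAt (𝓡 4) x₀).symm y) (X ((extChartAt (𝓡 4) x₀).symm y))) T < 0 := by
    have h := continuousAt_extChartAt_symm'' htgt
    rw [ContinuousAt, (extChartAt (𝓡 4) x₀).left_inv hsrc] at h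
    exact h.eventually ((Filter.eventually_mem_set.2 hW).and hev1)
  obtain ⟨R, hR, hball⟩ := Metric.eventually_nhds_iff_ball.1
    ((Filter.eventually_mem_set.2 ((isOpen_extChartAt_target x₀).mem_nhds htgt)).and
      (hev2.and hev3))
  refine ⟨R, hR, fun y hy ↦ (hball y hy).1, fun y hy ↦ (hball y hy).2.1, fun x hx v ↦ ?_⟩
  obtain ⟨-, hTx, hxW, hXT⟩ := hball _ hx.2
  rw [(extChartAt (𝓡 4) x₀).left_inv hx.1] at hxW hXT
  rw [← g.val_chartSymmDeriv hx.1] at hTx hXT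
  rw [chartSymmDeriv_chartDeriv hx.1] at hXT
  rw [← g.val_chartSymmDeriv hx.1, ← g.val_chartSymmDeriv hx.1]
  obtain ⟨u₀, hu₀, hcone⟩ := τ.isTimecone x
  have hXx := hXc x hxW
  rw [hcone] at hXx
  have key : g.form x (chartSymmDeriv x₀ (extChartAt (𝓡 4) x₀ x) v)
      (chartSymmDeriv x₀ (extChartAt (𝓡 4) x₀ x) v) ≤ 0 → _ := fun hv ↦
    (g.isLorentzForm_form x).forall_cone_neg_iff hu₀ hXx.1 hXx.2 hTx hXT hv
  constructor
  · rintro ⟨h1, h2, h3⟩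
    refine ⟨fun h ↦ h1 ((chartSymmDeriv_eq_zero_iff hx.1 v).2 h), h2, (key h2).1 ?_⟩
    intro u hu
    refine h3 u ?_
    rw [hcone]
    exact hu
  · rintro ⟨h1, h2, h3⟩
    refine ⟨fun h ↦ h1 ((chartSymmDeriv_eq_zero_iff hx.1 v).1 h), h2, ?_⟩
    intro u hu
    rw [hcone] at hu
    exact (key h2).2 h3 u hu

/-- This lets past-pointing rays be handled by the same existence and uniqueness result, with `-T`
in place of `T`. -/
theorem TimeOrientation.isConeNear_past {g : LorentzMetric M} {τ : TimeOrientation g} {x₀ : M}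
    {T : 𝔼} {R : ℝ} (h : IsConeNear g x₀ (fun _ v ↦ τ.FuturePointing v) T R) :
    IsConeNear g x₀ (fun _ v ↦ τ.PastPointing v) (-T) R where
  subset_target := h.subset_target
  timelike y hy := by simpa using h.timelike y hy
  iff x hx v := by
    have h1 := h.iff x hx (-v)
    rw [map_neg] at h1
    refine Iff.trans h1 ?_
    simp

end Orientation

/-! ### The clock in coordinates and the radar neighborhood. -/

section Clock

set_option maxSynthPendingDepth 3

variable {M : Type*} [TopologicalSpace M] [ChartedSpace (EuclideanSpace ℝ (Fin 4)) M]
  [IsManifold (𝓡 4) ∞ M]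

local notation "𝔼" => EuclideanSpace ℝ (Fin 4)

/-- The coordinate velocity of a clock. -/
theorem IsClock.exists_chart_velocity {g : LorentzMetric M} {τ : TimeOrientation g} {I : Set ℝ}
    {γ : ℝ → M} (hγ : IsClock τ I γ) {t₀ : ℝ} (ht₀ : t₀ ∈ interior I) :
    ∃ T : 𝔼, HasStrictDerivAt (fun t ↦ extChartAt (𝓡 4) (γ t₀) (γ t)) T t₀ ∧
      velocity γ I t₀ = chartSymmDeriv (γ t₀) (extChartAt (𝓡 4) (γ t₀) (γ t₀)) T := by
  have hI : I ∈ 𝓝 t₀ := mem_interior_iff_mem_nhds.1 ht₀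
  have ht₀I : t₀ ∈ I := interior_subset ht₀
  have hγc : ContMDiffAt 𝓘(ℝ, ℝ) (𝓡 4) ∞ γ t₀ := (hγ.smooth t₀ ht₀I).contMDiffAt hI
  have hβ : ContDiffAt ℝ ∞ (fun t ↦ extChartAt (𝓡 4) (γ t₀) (γ t)) t₀ :=
    contMDiffAt_iff_contDiffAt.1 (contMDiffAt_extChartAt.comp t₀ hγc)
  refine ⟨deriv (fun t ↦ extChartAt (𝓡 4) (γ t₀) (γ t)) t₀, hβ.hasStrictDerivAt (by simp), ?_⟩
  have h := (velocity_eq (x₀ := γ t₀) (hγc.mdifferentiableAt (by simp)).mdifferentiableWithinAt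
    ht₀I (uniqueDiffWithinAt_of_mem_nhds hI) (mem_extChartAt_source (γ t₀))).2
  rwa [derivWithin_of_mem_nhds hI] at h

end Clock

theorem proposition1 {M : Type*} [TopologicalSpace M] [T2Space M]
    [ChartedSpace (EuclideanSpace ℝ (Fin 4)) M] [IsManifold (𝓡 4) ∞ M]
    (g : LorentzMetric M) (τ : TimeOrientation g)
    (I : Set ℝ) (γ : ℝ → M) (hγ : IsClock τ I γ) (t₀ : ℝ) (ht₀ : t₀ ∈ interior I) :
    ∃ U V : Set M, IsOpen U ∧ IsOpen V ∧ γ t₀ ∈ U ∧ U ⊆ V ∧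
      ∀ q ∈ U \ γ '' I,
        (∃ c : ℝ → M, τ.IsFutureLightRay V q (γ '' I) c ∧
          ∀ c' : ℝ → M, τ.IsFutureLightRay V q (γ '' I) c' → Set.EqOn c' c (Set.Icc 0 1)) ∧
        (∃ c : ℝ → M, τ.IsPastLightRay V q (γ '' I) c ∧
          ∀ c' : ℝ → M, τ.IsPastLightRay V q (γ '' I) c' → Set.EqOn c' c (Set.Icc 0 1)) := by
  have hI : I ∈ 𝓝 t₀ := mem_interior_iff_mem_nhds.1 ht₀
  have ht₀I : t₀ ∈ I := interior_subset ht₀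
  obtain ⟨T, hβ, hvel⟩ := hγ.exists_chart_velocity ht₀
  have hTt := hγ.timelike t₀ ht₀I
  have hTf := hγ.futurePointing t₀ ht₀I
  rw [hvel] at hTt hTf
  have hT : g.chartMetric (γ t₀) (extChartAt (𝓡 4) (γ t₀) (γ t₀)) T T < 0 := by
    rw [← g.val_chartSymmDeriv (mem_extChartAt_source (γ t₀))]
    exact hTt
  obtain ⟨R₀, hR₀, hcone⟩ := τ.exists_isConeNear hT hTf
  have hγc : ContinuousAt γ t₀ := ((hγ.smooth t₀ ht₀I).contMDiffAt hI).continuousAt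
  have hS₁ : ∀ᶠ t in 𝓝 t₀, extChartAt (𝓡 4) (γ t₀) (γ t) ∈
      extChartAt (𝓡 4) (γ t₀) '' (γ '' I ∩ (extChartAt (𝓡 4) (γ t₀)).source) := by
    filter_upwards [hI, hγc.preimage_mem_nhds (extChartAt_source_mem_nhds (I := 𝓡 4) (γ t₀))]
      with t ht hts
    exact ⟨γ t, ⟨⟨t, ht, rfl⟩, hts⟩, rfl⟩
  -- The reversed clock has coordinate velocity `-T` at parameter `-t₀`, which matches the past
  -- cone.
  have hrev : HasStrictDerivAt (fun t : ℝ ↦ -t) (-1) (-t₀) := (hasStrictDerivAt_id (-t₀)).neg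
  have hβ' : HasStrictDerivAt (fun t ↦ extChartAt (𝓡 4) (γ t₀) (γ (-t))) (-T) (-t₀) := by
    have h : HasStrictDerivAt (fun t ↦ extChartAt (𝓡 4) (γ t₀) (γ t)) T (-(-t₀)) := by
      rwa [neg_neg]
    have h' := HasStrictDerivAt.scomp (-t₀) h hrev
    rwa [neg_one_smul] at h'
  obtain ⟨R₁, hR₁, hfut⟩ := exists_unique_lightRay hR₀ hcone hβ rfl hS₁
    fun η hη ↦ eventually_mem_image_chart hγ.embedding ht₀I hη
  obtain ⟨R₂, hR₂, hpast⟩ := exists_unique_lightRay hR₀ (TimeOrientation.isConeNear_past hcone) hβ'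
    (by simp only [neg_neg])
    (by
      have h : Filter.Tendsto (fun t : ℝ ↦ -t) (𝓝 (-t₀)) (𝓝 t₀) := by
        simpa using (continuous_neg (G := ℝ)).tendsto (-t₀)
      exact h.eventually hS₁)
    (fun η hη ↦ (eventually_mem_image_chart hγ.embedding ht₀I hη).mono fun x hx hxS ↦ by
      obtain ⟨t, ht, htx⟩ := hx hxS
      refine ⟨-t, ?_, by simpa only [neg_neg] using htx⟩
      rwa [← neg_sub', abs_neg])
  -- One ball serves as `V` for both families of rays.
  set r := min R₁ R₂ with hr
  have hr0 : 0 < r := lt_min hR₁ hR₂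
  obtain ⟨U, hU, hUo, hpU⟩ := mem_nhds_iff.1
    ((hfut r hr0 (min_le_left _ _)).and (hpast r hr0 (min_le_right _ _)))
  refine ⟨U ∩ chartBall (γ t₀) r, chartBall (γ t₀) r, hUo.inter (isOpen_chartBall _ _),
    isOpen_chartBall _ _, ⟨hpU, mem_chartBall_self _ hr0⟩, Set.inter_subset_right, ?_⟩
  rintro q ⟨⟨hqU, -⟩, hqS⟩
  exact ⟨(hU hqU).1 hqS, (hU hqU).2 hqS⟩
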